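/- Setting. Let $N\ge 1$, $B,T,E,X\ge 0$ be integers with $4B\le N$, $\max(T,E)\le B$ and $X\le B$. There are $K\ge 1$ messages $W_1,\dots,W_K$, independent and uniform on $\Sigma^L$, where $\Sigma$ is a finite alphabet with $|\Sigma|\ge 2$ and $L\ge 1$. A scheme consists of $\Sigma$, $L$, finite alphabets, and: a (randomized) encoding of the messages into the storages $S_1,\dots,S_N$ of the $N$ servers; masking variables $(Z_1,\dots,Z_N)$ of arbitrary joint law, independent of messages, storages and queries; for each index $\theta\in[K]$ a law of the queries $Q^{[\theta]}_{1},\dots,Q^{[\theta]}_{N}$, which are drawn independently of messages, storages and masks; for each server $n$ an answer function of $(S_n,Q_n^{[\theta]},Z_n)$; and one decoder, a function of $\theta$, all queries and all answers. The required index $\theta$ is uniform on $[K]$. An unknown set $\mathcal B\subset[N]$ of at most $B$ servers is Byzantine: instead of its prescribed answer, each server $n\in\mathcal B$ sends an arbitrary function (with values in its answer alphabet) of $S_{\mathcal B},Q^{[\theta]}_{\mathcal B},Z_{\mathcal B}$ and of $\gamma_n$, where $(\gamma_n)_{n\in\mathcal B}$ is an arbitrary discrete random vector independent of all the other variables. All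 other servers answer as prescribed. Write $A_n^{[\theta]}$ for the answers received. A scheme is valid if for every $\mathcal B$ with $|\mathcal B|\le B$ and every behaviour of the servers in $\mathcal B$: - (correctness) the decoder, which knows neither $\mathcal B$ nor the behaviour, outputs $W_\theta$ without error; - (symmetric privacy) $I(W_{[K]\setminus\theta};A^{[\theta]}_{[N]},Q^{[\theta]}_{[N]})=0$ for every $\theta$; - (Byzantine security and privacy) $I(A^{[\theta]}_{\mathcal B};W_{[K]})=0$ for every $\theta$, and $I(S_{\mathcal I};W_{[K]})=0$ and $I(Q^{[\theta]}_{\mathcal I};\theta)=0$ whenever $|\mathcal I|\le B$; - ($X$-security) $I(S_{\mathcal I};W_{[K]})=0$ whenever $|\mathcal I|\le X$; - ($T$-colluding servers) $I(Q^{[\theta]}_{\mathcal I};\theta)=0$ whenever $|\mathcal I|\le T$; - ($E$ eavesdropped links) $I(W_{[K]};Q^{[\theta]}_{\mathcal I},A^{[\theta]}_{\mathcal I})=0$ for every $\theta$ whenever $|\mathcal I|\le E$. The rate of a scheme is the infimum, over all behaviours of at most $B$ Byzantine servers, of $L/\sum_{n=1}^N H(A_n^{[\theta]})$, with $H$ in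 units of $\log|\Sigma|$. The capacity $C(K)$ is the supremum of the rates of all valid schemes with $K$ messages ($0$ if there is none). Claim. The asymptotic capacity is $$C_{EBXTSPIR}(E,B,X,T,N,\infty)=\lim_{K\to\infty}C(K)=1-\frac{4B}{N}.$$ -/

import Mathlib

open Filter Topology
open scoped ENNReal

/-! ### Discrete information measures -/

/-- Shannon entropy `H(X)` (in nats) of a finitely valued random variable `X` on a discrete
probability space with law `p`. -/
noncomputable def shannonEntropy {Ω α : Type} [Fintype α] (p : PMF Ω) (X : Ω → α) : ℝ :=
  ∑ a, Real.negMulLog ((p.map X) a).toReal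

/-- Mutual information `I(X;Y) = H(X) + H(Y) - H(X,Y)`. -/
noncomputable def mutualInfo {Ω α β : Type} [Fintype α] [Fintype β]
    (p : PMF Ω) (X : Ω → α) (Y : Ω → β) : ℝ :=
  shannonEntropy p X + shannonEntropy p Y - shannonEntropy p (fun ω => (X ω, Y ω))

namespace BSPIR

/-- A (fully general, randomized) retrieval scheme with `N` servers and `K` messages, each message
being a word of length `L` over a finite alphabet `Sym`. The alphabets of storage, queries, masking
variables and answers are finite and may depend on the server. -/
structure Scheme (N K : ℕ) where
  Sym : Type
  [fintypeSym : Fintype Sym]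
  [nontrivialSym : Nontrivial Sym]
  L : ℕ
  L_pos : 0 < L
  /-- alphabet of the storage `S_n` -/
  Stor : Fin N → Type
  [fintypeStor : ∀ n, Fintype (Stor n)]
  /-- alphabet of the query `Q_n` -/
  Que : Fin N → Type
  [fintypeQue : ∀ n, Fintype (Que n)]
  /-- alphabet of the masking variable `Z_n` -/
  Mask : Fin N → Type
  [fintypeMask : ∀ n, Fintype (Mask n)]
  /-- alphabet of the answer `A_n` -/
  Ans : Fin N → Type
  [fintypeAns : ∀ n, Fintype (Ans n)]
  /-- conditional law of the storage of all servers given the messages -/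
  storage : (Fin K → Fin L → Sym) → PMF ((n : Fin N) → Stor n)
  /-- joint law of the masking variables of the servers -/
  masking : PMF ((n : Fin N) → Mask n)
  /-- conditional law of the queries to all servers given the required index -/
  query : Fin K → PMF ((n : Fin N) → Que n)
  /-- answer of an honest server, a function of its storage, its query and its mask -/
  answer : (n : Fin N) → Stor n → Que n → Mask n → Ans n
  /-- the user's decoder, which is not told which servers are Byzantine nor what they do -/
  decode : Fin K → ((n : Fin N) → Que n) → ((n : Fin N) → Ans n) → (Fin L → Sym)

attribute [instance] Scheme.fintypeSym Scheme.nontrivialSym Scheme.fintypeStor Scheme.fintypeQue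
  Scheme.fintypeMask Scheme.fintypeAns

variable {N K : ℕ}

/-- The messages `W_{[K]}`. -/
abbrev Scheme.Messages (S : Scheme N K) : Type := Fin K → Fin S.L → S.Sym

/-- A behaviour of at most `B` Byzantine servers: the set `servers` of Byzantine servers, the joint
law of the auxiliary variables `γ_n`, `n ∈ servers` (chosen by the coalition, possibly correlated
with each other, independent of everything else), and for each Byzantine server `n` its answer as an
arbitrary function of the storage, the queries and the masks of the whole coalition and
of `γ_n`. -/
structure Byzantine (S : Scheme N K) (B : ℕ) where
  servers : Finset (Fin N)
  card_le : servers.card ≤ B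
  Aux : Type
  aux : PMF (servers → Aux)
  respond : (n : servers) → ((m : servers) → S.Stor m) → ((m : servers) → S.Que m) →
    ((m : servers) → S.Mask m) → Aux → S.Ans n

/-- An outcome of one run: required index, messages, storage, masks, queries, received answers. -/
structure Outcome (P : Scheme N K) where
  θ : Fin K
  W : P.Messages
  S : (n : Fin N) → P.Stor n
  Z : (n : Fin N) → P.Mask n
  Q : (n : Fin N) → P.Que n
  A : (n : Fin N) → P.Ans n

/-- The answers received by the user: honest servers answer according to the scheme, Byzantine
servers according to their plan `byz`. -/
noncomputable def received (S : Scheme N K) {B : ℕ} (byz : Byzantine S B)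
    (s : (n : Fin N) → S.Stor n) (q : (n : Fin N) → S.Que n) (z : (n : Fin N) → S.Mask n)
    (γ : byz.servers → byz.Aux) (n : Fin N) : S.Ans n :=
  if h : n ∈ byz.servers then
    byz.respond ⟨n, h⟩ (fun m => s m) (fun m => q m) (fun m => z m) (γ ⟨n, h⟩)
  else S.answer n (s n) (q n) (z n)

/-- Law of a run when the required index is `θ`. The messages are independent and uniform; the
pair (messages, storage), the masks, the queries and the auxiliary variables of the Byzantine servers
are independent. -/
noncomputable def lawGiven (S : Scheme N K) {B : ℕ} (byz : Byzantine S B) (θ : Fin K) :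
    PMF (Outcome S) :=
  (PMF.uniformOfFintype S.Messages).bind fun w =>
  (S.storage w).bind fun s =>
  S.masking.bind fun z =>
  (S.query θ).bind fun q =>
  byz.aux.bind fun γ =>
  PMF.pure ⟨θ, w, s, z, q, received S byz s q z γ⟩

/-- Law of a run when the required index is uniform on the set of indices. -/
noncomputable def law [NeZero K] (S : Scheme N K) {B : ℕ} (byz : Byzantine S B) :
    PMF (Outcome S) :=
  (PMF.uniformOfFintype (Fin K)).bind fun θ => lawGiven S byz θ

/-! Sub-collections of the random variables of a run. -/

/-- `S_I` for a set `I` of servers. -/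
def Outcome.stor {S : Scheme N K} (I : Finset (Fin N)) (ω : Outcome S) : (n : I) → S.Stor n :=
  fun n => ω.S n

/-- `Q_I` for a set `I` of servers. -/
def Outcome.que {S : Scheme N K} (I : Finset (Fin N)) (ω : Outcome S) : (n : I) → S.Que n :=
  fun n => ω.Q n

/-- `A_I` for a set `I` of servers. -/
def Outcome.ans {S : Scheme N K} (I : Finset (Fin N)) (ω : Outcome S) : (n : I) → S.Ans n :=
  fun n => ω.A n

/-- The messages other than the one with index `k`. -/
def Outcome.others {S : Scheme N K} (k : Fin K) (ω : Outcome S) :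
    {j : Fin K // j ≠ k} → Fin S.L → S.Sym :=
  fun j => ω.W j

/-- `S` is a symmetric private retrieval scheme that withstands `B` Byzantine servers, with `T`
colluding servers, `X`-secure storage and `E` eavesdropped links. Each requirement that concerns
answers is imposed for every set of at most `B` Byzantine servers and every behaviour of them. -/
structure IsValid [NeZero K] (S : Scheme N K) (B T E X : ℕ) : Prop where
  /-- the required message is decoded without error, whatever the Byzantine servers do -/
  correct : ∀ (byz : Byzantine S B) (k : Fin K), ∀ ω ∈ (lawGiven S byz k).support,
    S.decode k ω.Q ω.A = ω.W k
  /-- symmetric privacy: `I(W_{[K] ∖ θ} ; A_{[N]}, Q_{[N]}) = 0` -/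
  symmetric : ∀ (byz : Byzantine S B) (k : Fin K),
    mutualInfo (lawGiven S byz k) (Outcome.others k) (fun ω => (ω.A, ω.Q)) = 0
  /-- the answers of the Byzantine servers carry no information on the messages -/
  byzantine_answers : ∀ (byz : Byzantine S B) (k : Fin K),
    mutualInfo (lawGiven S byz k) (Outcome.ans byz.servers) Outcome.W = 0
  /-- the storage of any `B` servers reveals nothing on the messages -/
  byzantine_secure : ∀ (byz : Byzantine S B) (I : Finset (Fin N)), I.card ≤ B →
    mutualInfo (law S byz) (Outcome.stor I) Outcome.W = 0
  /-- the queries to any `B` servers reveal nothing on the required index -/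
  byzantine_private : ∀ (byz : Byzantine S B) (I : Finset (Fin N)), I.card ≤ B →
    mutualInfo (law S byz) (Outcome.que I) Outcome.θ = 0
  /-- `X`-security: the storage of any `X` servers reveals nothing on the messages -/
  secure : ∀ (byz : Byzantine S B) (I : Finset (Fin N)), I.card ≤ X →
    mutualInfo (law S byz) (Outcome.stor I) Outcome.W = 0
  /-- `T`-privacy: the queries to any `T` servers reveal nothing on the required index -/
  colluding : ∀ (byz : Byzantine S B) (I : Finset (Fin N)), I.card ≤ T →
    mutualInfo (law S byz) (Outcome.que I) Outcome.θ = 0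
  /-- a passive eavesdropper who taps the queries and the answers on any `E` links learns nothing
  about the messages -/
  eavesdropper : ∀ (byz : Byzantine S B) (k : Fin K) (I : Finset (Fin N)), I.card ≤ E →
    mutualInfo (lawGiven S byz k) (fun ω => (ω.que I, ω.ans I)) Outcome.W = 0

/-- The rate `L / ∑ H(A_n)`, entropies being measured in symbols of the message alphabet, that
the scheme guarantees against every behaviour of at most `B` Byzantine servers. Numerator and
denominator are both written in nats. -/
noncomputable def Scheme.rate [NeZero K] (S : Scheme N K) (B : ℕ) : ℝ≥0∞ :=
  ⨅ byz : Byzantine S B,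
    ENNReal.ofReal (S.L * Real.log (Fintype.card S.Sym)) /
      ENNReal.ofReal (∑ n, shannonEntropy (law S byz) (fun ω => ω.A n))

/-- The capacity for `N` servers and `K` messages: the supremum of the rates of all valid schemes
(equal to `0` if there is none). -/
noncomputable def capacity (N K : ℕ) [NeZero K] (B T E X : ℕ) : ℝ≥0∞ :=
  ⨆ (S : Scheme N K) (_ : IsValid S B T E X), S.rate B

end BSPIR

/-! The limit is squeezed between a bound on the rate for each number of messages and a scheme of
rate $1-4B/N$. Converse. The honest answers of any $N-2B$ servers determine the required message: if
two states of the system agree on them, the other $2B$ servers split into two sets of size at most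
$B$, and the user may receive the same answers from either state, one set lying in the first case
and the other in the second (`IsValid.determined`). Give away the masks and the storage of a set $I$
of $B$ servers. Both together are independent of the messages and yield the answers of $I$, so the
answers of $N-3B$ further servers $M$ must suffice. Conditioned on the side information and on the
first $k$ messages, the entropy of these answers drops by a whole message when message $k$ becomes
known (`IsValid.condEnt_succ_le`). To continue with the next index, pass to $B$ servers of $M$ with
at least a proportional share of the entropy (`exists_subset_card_of_submodular`); their queries do
not reveal the index, so the change costs a factor $B/(N-3B)$ (`IsValid.avgCondEnt_index`).
Iteration gives a geometric sum with ratio $B/(N-3B)$. Choosing for $M$ the cheapest $N-3B$ servers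
bounds the total download (`IsValid.download_ge`), and as the number of messages grows the rate
bound tends to $\frac{N-3B}{N}\bigl(1-\frac{B}{N-3B}\bigr)=1-\frac{4B}{N}$. Achievability. With
$L=N-4B$, messages and the unit vector of the index are Shamir-shared with $B$-fold randomness. The
answers are values of a polynomial of degree less than $L+2B=N-2B$ whose values at the $L$ secret
positions give the required message; everything else is hidden by a mask with $2B$ free
coefficients. This is a Reed-Solomon code that corrects $B$ errors (`decodeWord_eq`). Every secrecy
condition on the messages follows from translations of the randomness that leave the observer's view
unchanged (`lawGiven_map_shift`, `mutualInfo_eq_zero_of_transitive`). -/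

section Entropy

/-! ### Entropy and mutual information of finitely valued variables. -/

variable {Ω α β γ : Type}

/-- The probability that `X` takes the value `a`, as a real number. -/
noncomputable def pmfProb (p : PMF Ω) (X : Ω → α) (a : α) : ℝ := ((p.map X) a).toReal

lemma pmfProb_nonneg (p : PMF Ω) (X : Ω → α) (a : α) : 0 ≤ pmfProb p X a := ENNReal.toReal_nonneg

lemma PMF.map_congr_support {p : PMF Ω} {X Y : Ω → α} (h : ∀ ω ∈ p.support, X ω = Y ω) :
    p.map X = p.map Y := by
  classical
  ext a
  rw [PMF.map_apply, PMF.map_apply]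
  refine tsum_congr fun ω => ?_
  by_cases hω : ω ∈ p.support
  · rw [h ω hω]
  · rw [PMF.mem_support_iff, not_not] at hω
    simp [hω]

open Classical in
lemma pmfProb_comp [Fintype α] (p : PMF Ω) (X : Ω → α) (f : α → β) (b : β) :
    pmfProb p (fun ω => f (X ω)) b = ∑ a, if b = f a then pmfProb p X a else 0 := by
  have h : p.map (fun ω => f (X ω)) = (p.map X).map f := by rw [PMF.map_comp]; rfl
  unfold pmfProb
  rw [h, PMF.map_apply, tsum_fintype, ENNReal.toReal_sum]
  · exact Finset.sum_congr rfl fun a _ => by split_ifs <;> simp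
  · intro a _
    split_ifs
    · exact (p.map X).apply_ne_top a
    · simp

variable [Fintype α]

lemma PMF.toReal_sum_eq_one (μ : PMF α) : ∑ a, (μ a).toReal = 1 := by
  rw [← ENNReal.toReal_sum (fun a _ => μ.apply_ne_top a), ← tsum_fintype (L := .unconditional _),
    μ.tsum_coe, ENNReal.toReal_one]

lemma sum_pmfProb (p : PMF Ω) (X : Ω → α) : ∑ a, pmfProb p X a = 1 :=
  (p.map X).toReal_sum_eq_one

lemma pmfProb_le_comp (p : PMF Ω) (X : Ω → α) (f : α → β) (a : α) :
    pmfProb p X a ≤ pmfProb p (fun ω => f (X ω)) (f a) := by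
  classical
  rw [pmfProb_comp p X f]
  calc pmfProb p X a = if f a = f a then pmfProb p X a else 0 := by simp
    _ ≤ _ := Finset.single_le_sum (f := fun x => if f a = f x then pmfProb p X x else 0)
      (fun x _ => by split_ifs <;> simp [pmfProb_nonneg]) (Finset.mem_univ a)

variable [Fintype β] [Fintype γ]

lemma pmfProb_fst (p : PMF Ω) (X : Ω → α) (Y : Ω → β) (a : α) :
    pmfProb p X a = ∑ b, pmfProb p (fun ω => (X ω, Y ω)) (a, b) := by
  classical
  have := pmfProb_comp p (fun ω => (X ω, Y ω)) Prod.fst a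
  simp only [Fintype.sum_prod_type] at this
  rw [this, Finset.sum_eq_single a]
  · simp
  · intro b _ hb
    simp [Ne.symm hb]
  · simp

lemma pmfProb_snd (p : PMF Ω) (X : Ω → α) (Y : Ω → β) (b : β) :
    pmfProb p Y b = ∑ a, pmfProb p (fun ω => (X ω, Y ω)) (a, b) := by
  classical
  have := pmfProb_comp p (fun ω => (X ω, Y ω)) Prod.snd b
  simp only [Fintype.sum_prod_type_right] at this
  rw [this, Finset.sum_eq_single b]
  · simp
  · intro c _ hc
    simp [Ne.symm hc]
  · simp

lemma shannonEntropy_def (p : PMF Ω) (X : Ω → α) :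
    shannonEntropy p X = ∑ a, Real.negMulLog (pmfProb p X a) := rfl

/-- The entropy of `f (X)` as an expectation over the values of `X`. -/
lemma shannonEntropy_comp_eq (p : PMF Ω) (X : Ω → α) (f : α → β) :
    shannonEntropy p (fun ω => f (X ω)) =
      ∑ a, -(pmfProb p X a * Real.log (pmfProb p (fun ω => f (X ω)) (f a))) := by
  classical
  rw [shannonEntropy_def]
  have h : ∀ b, Real.negMulLog (pmfProb p (fun ω => f (X ω)) b) =
      ∑ a, if b = f a then -(pmfProb p X a * Real.log (pmfProb p (fun ω => f (X ω)) (f a)))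
        else 0 := by
    intro b
    have h2 : ∀ a, (if b = f a then
        -(pmfProb p X a * Real.log (pmfProb p (fun ω => f (X ω)) (f a))) else 0) =
        (if b = f a then pmfProb p X a else 0) *
          (-Real.log (pmfProb p (fun ω => f (X ω)) b)) := by
      intro a
      split_ifs with hb
      · rw [hb]; ring
      · simp
    rw [Finset.sum_congr rfl fun a _ => h2 a, ← Finset.sum_mul, ← pmfProb_comp, Real.negMulLog]
    ring
  rw [Finset.sum_congr rfl fun b _ => h b, Finset.sum_comm]
  exact Finset.sum_congr rfl fun a _ => by simp

lemma shannonEntropy_eq_sum (p : PMF Ω) (X : Ω → α) :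
    shannonEntropy p X = ∑ a, -(pmfProb p X a * Real.log (pmfProb p X a)) :=
  shannonEntropy_comp_eq p X id

lemma shannonEntropy_comp_le (p : PMF Ω) (X : Ω → α) (f : α → β) :
    shannonEntropy p (fun ω => f (X ω)) ≤ shannonEntropy p X := by
  rw [shannonEntropy_comp_eq, shannonEntropy_eq_sum]
  refine Finset.sum_le_sum fun a _ => neg_le_neg ?_
  rcases (pmfProb_nonneg p X a).eq_or_lt with h | h
  · simp [← h]
  · exact mul_le_mul_of_nonneg_left (Real.log_le_log h (pmfProb_le_comp p X f a)) h.le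

/-- If the value of `X` determines that of `Y` almost surely, then `H(Y) ≤ H(X)`. -/
lemma shannonEntropy_le_of_determines (p : PMF Ω) (X : Ω → α) (Y : Ω → β)
    (h : ∀ ω ∈ p.support, ∀ ω' ∈ p.support, X ω = X ω' → Y ω = Y ω') :
    shannonEntropy p Y ≤ shannonEntropy p X := by
  classical
  obtain ⟨ω₀, -⟩ := p.support_nonempty
  let f : α → β := fun a => if h : ∃ ω ∈ p.support, X ω = a then Y h.choose else Y ω₀
  have hf : p.map Y = p.map (fun ω => f (X ω)) := by
    refine PMF.map_congr_support fun ω hω => ?_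
    have hex : ∃ ω' ∈ p.support, X ω' = X ω := ⟨ω, hω, rfl⟩
    simp only [f, dif_pos hex]
    exact h _ hω _ hex.choose_spec.1 hex.choose_spec.2.symm
  have : shannonEntropy p Y = shannonEntropy p (fun ω => f (X ω)) := by
    simp only [shannonEntropy, hf]
  rw [this]
  exact shannonEntropy_comp_le p X f

lemma shannonEntropy_congr (p : PMF Ω) (X : Ω → α) (Y : Ω → β)
    (h : ∀ ω ω', X ω = X ω' ↔ Y ω = Y ω') : shannonEntropy p X = shannonEntropy p Y :=
  le_antisymm (shannonEntropy_le_of_determines p Y X fun ω _ ω' _ => (h ω ω').2)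
    (shannonEntropy_le_of_determines p X Y fun ω _ ω' _ => (h ω ω').1)

/-- This is $\log x\le x-1$ at $x=b/a$, the pointwise form of Gibbs' inequality; the next lemma is
its equality case. -/
lemma Real.sub_le_mul_log_sub_log {a b : ℝ} (ha : 0 ≤ a) (hb : 0 ≤ b) (hab : 0 < a → 0 < b) :
    a - b ≤ a * (Real.log a - Real.log b) := by
  rcases ha.eq_or_lt with rfl | ha
  · simpa using hb
  · have hb' := hab ha
    have h := Real.log_le_sub_one_of_pos (div_pos hb' ha)
    rw [Real.log_div hb'.ne' ha.ne'] at h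
    have h2 := mul_le_mul_of_nonneg_left h ha.le
    have h3 : a * (b / a - 1) = b - a := by field_simp
    rw [h3] at h2
    linarith

lemma Real.eq_of_mul_log_sub_log_le {a b : ℝ} (ha : 0 ≤ a) (hab : 0 < a → 0 < b)
    (h : a * (Real.log a - Real.log b) ≤ a - b) (hb : 0 ≤ b) : a = b := by
  rcases ha.eq_or_lt with rfl | ha
  · simp at h; linarith
  · by_contra hne
    have hb' := hab ha
    have h1 : b / a ≠ 1 := by
      rw [Ne, div_eq_one_iff_eq ha.ne']; exact fun h => hne h.symm
    have h := Real.log_lt_sub_one_of_pos (div_pos hb' ha) h1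
    rw [Real.log_div hb'.ne' ha.ne'] at h
    have h2 := mul_lt_mul_of_pos_left h ha
    have h3 : a * (b / a - 1) = b - a := by field_simp
    rw [h3] at h2
    linarith

/-- Submodularity of entropy: `I(X;Y|Z) ≥ 0`. -/
theorem shannonEntropy_submodular (p : PMF Ω) (X : Ω → α) (Y : Ω → β) (Z : Ω → γ) :
    shannonEntropy p (fun ω => (X ω, Y ω, Z ω)) + shannonEntropy p Z ≤
      shannonEntropy p (fun ω => (X ω, Z ω)) + shannonEntropy p (fun ω => (Y ω, Z ω)) := by
  set V : Ω → α × β × γ := fun ω => (X ω, Y ω, Z ω)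
  set Pz := pmfProb p Z with hPz
  set Pxz := pmfProb p (fun ω => (X ω, Z ω)) with hPxz
  set Pyz := pmfProb p (fun ω => (Y ω, Z ω)) with hPyz
  set P := pmfProb p V with hP
  have e1 := shannonEntropy_comp_eq p V id
  have e2 := shannonEntropy_comp_eq p V (fun v => v.2.2)
  have e3 := shannonEntropy_comp_eq p V (fun v => (v.1, v.2.2))
  have e4 := shannonEntropy_comp_eq p V (fun v => (v.2.1, v.2.2))
  simp only [V, id] at e1 e2 e3 e4
  rw [e1, e2, e3, e4, ← Finset.sum_add_distrib, ← Finset.sum_add_distrib]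
  -- Gibbs' inequality against the law under which $X$ and $Y$ are conditionally independent given
  -- $Z$. It has total mass 1 as well, so the left sides add up to 0.
  have key : ∀ v : α × β × γ, P v - Pxz (v.1, v.2.2) * Pyz (v.2.1, v.2.2) / Pz v.2.2 ≤
      (-(P v * Real.log (Pxz (v.1, v.2.2))) + -(P v * Real.log (Pyz (v.2.1, v.2.2)))) -
      (-(P v * Real.log (P v)) + -(P v * Real.log (Pz v.2.2))) := by
    intro v
    have l1 : P v ≤ Pz v.2.2 := pmfProb_le_comp p V (fun v => v.2.2) v
    have l2 : P v ≤ Pxz (v.1, v.2.2) := pmfProb_le_comp p V (fun v => (v.1, v.2.2)) v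
    have l3 : P v ≤ Pyz (v.2.1, v.2.2) := pmfProb_le_comp p V (fun v => (v.2.1, v.2.2)) v
    have n0 : 0 ≤ P v := pmfProb_nonneg _ _ _
    have hb : 0 ≤ Pxz (v.1, v.2.2) * Pyz (v.2.1, v.2.2) / Pz v.2.2 :=
      div_nonneg (mul_nonneg (n0.trans l2) (n0.trans l3)) (n0.trans l1)
    refine (Real.sub_le_mul_log_sub_log n0 hb fun h => ?_).trans (le_of_eq ?_)
    · exact div_pos (mul_pos (h.trans_le l2) (h.trans_le l3)) (h.trans_le l1)
    · rcases n0.eq_or_lt with h | h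
      · simp [← h]
      · rw [Real.log_div (mul_pos (h.trans_le l2) (h.trans_le l3)).ne' (h.trans_le l1).ne',
          Real.log_mul (h.trans_le l2).ne' (h.trans_le l3).ne']
        ring
  have hsum := Finset.sum_le_sum fun v (_ : v ∈ Finset.univ) => key v
  rw [Finset.sum_sub_distrib, Finset.sum_sub_distrib] at hsum
  have h1 : ∑ v, P v = 1 := sum_pmfProb p V
  have h2 : ∑ v : α × β × γ, Pxz (v.1, v.2.2) * Pyz (v.2.1, v.2.2) / Pz v.2.2 = 1 := by
    rw [← sum_pmfProb p Z, Fintype.sum_prod_type]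
    simp only [Fintype.sum_prod_type_right]
    rw [Finset.sum_comm]
    refine Finset.sum_congr rfl fun z _ => ?_
    simp only [div_eq_mul_inv, ← Finset.mul_sum, ← Finset.sum_mul]
    have a1 : ∑ x, Pxz (x, z) = Pz z := (pmfProb_snd p X Z z).symm
    have a2 : ∑ y, Pyz (y, z) = Pz z := (pmfProb_snd p Y Z z).symm
    rw [a1, a2]
    by_cases h : Pz z = 0
    · rw [← hPz, h]; simp
    · rw [← hPz]; field_simp
  rw [h1, h2] at hsum
  linarith

lemma shannonEntropy_unit (p : PMF Ω) : shannonEntropy p (fun _ => ()) = 0 := by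
  have := sum_pmfProb p (fun _ => ())
  simp only [Finset.univ_unique, Finset.sum_singleton] at this
  simp [shannonEntropy_def, this]

lemma shannonEntropy_pair_le (p : PMF Ω) (X : Ω → α) (Y : Ω → β) :
    shannonEntropy p (fun ω => (X ω, Y ω)) ≤ shannonEntropy p X + shannonEntropy p Y := by
  have h := shannonEntropy_submodular p X Y (fun _ => ())
  rw [shannonEntropy_unit, shannonEntropy_congr p (fun ω => (X ω, Y ω, ())) (fun ω => (X ω, Y ω))
    (by simp), shannonEntropy_congr p (fun ω => (X ω, ())) X (by simp),
    shannonEntropy_congr p (fun ω => (Y ω, ())) Y (by simp)] at h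
  linarith

lemma mutualInfo_eq_sum (p : PMF Ω) (X : Ω → α) (Y : Ω → β) :
    mutualInfo p X Y = ∑ v : α × β, (pmfProb p (fun ω => (X ω, Y ω)) v *
      Real.log (pmfProb p (fun ω => (X ω, Y ω)) v) - pmfProb p (fun ω => (X ω, Y ω)) v *
        (Real.log (pmfProb p X v.1) + Real.log (pmfProb p Y v.2))) := by
  have e1 := shannonEntropy_comp_eq p (fun ω => (X ω, Y ω)) id
  have e2 := shannonEntropy_comp_eq p (fun ω => (X ω, Y ω)) Prod.fst
  have e3 := shannonEntropy_comp_eq p (fun ω => (X ω, Y ω)) Prod.snd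
  simp only [id] at e1 e2 e3
  rw [mutualInfo, e1, e2, e3, ← Finset.sum_add_distrib, ← Finset.sum_sub_distrib]
  exact Finset.sum_congr rfl fun v _ => by ring

lemma mutualInfo_eq_zero_of_indep (p : PMF Ω) (X : Ω → α) (Y : Ω → β)
    (h : ∀ a b, pmfProb p (fun ω => (X ω, Y ω)) (a, b) = pmfProb p X a * pmfProb p Y b) :
    mutualInfo p X Y = 0 := by
  rw [mutualInfo_eq_sum]
  refine Finset.sum_eq_zero fun v _ => ?_
  rcases (pmfProb_nonneg p (fun ω => (X ω, Y ω)) v).eq_or_lt with h0 | h0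
  · simp [← h0]
  · have hx : pmfProb p X v.1 ≠ 0 := fun hx => by
      rw [show v = (v.1, v.2) from rfl, h, hx, zero_mul] at h0; exact h0.false
    have hy : pmfProb p Y v.2 ≠ 0 := fun hy => by
      rw [show v = (v.1, v.2) from rfl, h, hy, mul_zero] at h0; exact h0.false
    have h1 := h v.1 v.2
    rw [← Real.log_mul hx hy, ← h1]
    simp

/-- Mutual information is a sum of terms, each at least $P-P_XP_Y$ at the given point, and these
lower bounds add up to 0. If the total vanishes, every one of these inequalities is an equality, and
strictness of $\log x<x-1$ for $x\ne1$ forces $P=P_XP_Y$. -/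
lemma indep_of_mutualInfo_eq_zero (p : PMF Ω) (X : Ω → α) (Y : Ω → β)
    (h : mutualInfo p X Y = 0) (a : α) (b : β) :
    pmfProb p (fun ω => (X ω, Y ω)) (a, b) = pmfProb p X a * pmfProb p Y b := by
  rw [mutualInfo_eq_sum] at h
  set P := pmfProb p (fun ω => (X ω, Y ω)) with hP
  have l1 : ∀ v, P v ≤ pmfProb p X v.1 := pmfProb_le_comp p (fun ω => (X ω, Y ω)) Prod.fst
  have l2 : ∀ v, P v ≤ pmfProb p Y v.2 := pmfProb_le_comp p (fun ω => (X ω, Y ω)) Prod.snd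
  have n0 : ∀ v, 0 ≤ P v := pmfProb_nonneg _ _
  have hlog : ∀ v, P v * Real.log (P v) -
      P v * (Real.log (pmfProb p X v.1) + Real.log (pmfProb p Y v.2)) =
      P v * (Real.log (P v) - Real.log (pmfProb p X v.1 * pmfProb p Y v.2)) := by
    intro v
    rcases (n0 v).eq_or_lt with h0 | h0
    · simp [← h0]
    · rw [Real.log_mul (h0.trans_le (l1 v)).ne' (h0.trans_le (l2 v)).ne']; ring
  have hpos : ∀ v, 0 < P v → 0 < pmfProb p X v.1 * pmfProb p Y v.2 := fun v h0 =>
    mul_pos (h0.trans_le (l1 v)) (h0.trans_le (l2 v))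
  have hnn : ∀ v : α × β, 0 ≤ pmfProb p X v.1 * pmfProb p Y v.2 := fun v =>
    mul_nonneg (pmfProb_nonneg _ _ _) (pmfProb_nonneg _ _ _)
  rw [Finset.sum_congr rfl fun v _ => hlog v] at h
  have hz : ∑ v, (P v * (Real.log (P v) - Real.log (pmfProb p X v.1 * pmfProb p Y v.2)) -
      (P v - pmfProb p X v.1 * pmfProb p Y v.2)) = 0 := by
    rw [Finset.sum_sub_distrib, h, Finset.sum_sub_distrib, hP, sum_pmfProb,
      Fintype.sum_prod_type]
    simp only [← Finset.mul_sum, sum_pmfProb]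
    simp [sum_pmfProb]
  have := (Finset.sum_eq_zero_iff_of_nonneg fun v _ => sub_nonneg.2
    (Real.sub_le_mul_log_sub_log (n0 v) (hnn v) (hpos v))).1 hz (a, b) (Finset.mem_univ _)
  exact Real.eq_of_mul_log_sub_log_le (n0 _) (hpos (a, b)) (sub_eq_zero.1 this).le (hnn (a, b))

/-- If the joint law of `X` and `Y` gives all values of `Y` the same weight, then `I(X;Y) = 0`. -/
lemma mutualInfo_eq_zero_of_const (p : PMF Ω) (X : Ω → α) (Y : Ω → β)
    (h : ∀ a b b', p.map (fun ω => (X ω, Y ω)) (a, b) = p.map (fun ω => (X ω, Y ω)) (a, b')) :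
    mutualInfo p X Y = 0 := by
  refine mutualInfo_eq_zero_of_indep p X Y fun a b => ?_
  have h' : ∀ a b b', pmfProb p (fun ω => (X ω, Y ω)) (a, b) =
      pmfProb p (fun ω => (X ω, Y ω)) (a, b') := fun a b b' => by simp only [pmfProb, h a b b']
  have hX : ∀ a, pmfProb p X a = Fintype.card β * pmfProb p (fun ω => (X ω, Y ω)) (a, b) := by
    intro a
    rw [pmfProb_fst p X Y, Finset.sum_congr rfl fun c _ => h' a c b]
    simp
  have hY : (Fintype.card β : ℝ) * pmfProb p Y b = 1 := by
    rw [pmfProb_snd p X Y, Finset.mul_sum, ← sum_pmfProb p X]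
    exact Finset.sum_congr rfl fun a _ => (hX a).symm
  rw [hX a, mul_right_comm, hY, one_mul]

lemma mutualInfo_comm (p : PMF Ω) (X : Ω → α) (Y : Ω → β) :
    mutualInfo p X Y = mutualInfo p Y X := by
  unfold mutualInfo
  rw [shannonEntropy_congr p (fun ω => (X ω, Y ω)) (fun ω => (Y ω, X ω))
    (by simp [and_comm]), add_comm (shannonEntropy p X)]

lemma shannonEntropy_le_log_card (p : PMF Ω) (X : Ω → α) :
    shannonEntropy p X ≤ Real.log (Fintype.card α) := by
  obtain ⟨ω₀, -⟩ := p.support_nonempty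
  have hc : (0 : ℝ) < Fintype.card α := by
    have : Nonempty α := ⟨X ω₀⟩
    exact_mod_cast Fintype.card_pos
  have h : ∀ a, pmfProb p X a - (Fintype.card α : ℝ)⁻¹ ≤ pmfProb p X a * Real.log (pmfProb p X a) +
      pmfProb p X a * Real.log (Fintype.card α) := by
    intro a
    have := Real.sub_le_mul_log_sub_log (pmfProb_nonneg p X a) (inv_nonneg.2 hc.le)
      (fun _ => inv_pos.2 hc)
    rw [Real.log_inv] at this
    linarith
  have hs := Finset.sum_le_sum fun a (_ : a ∈ Finset.univ) => h a
  rw [Finset.sum_sub_distrib, Finset.sum_add_distrib, ← Finset.sum_mul, sum_pmfProb] at hs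
  rw [shannonEntropy_eq_sum, Finset.sum_neg_distrib]
  simp only [Finset.sum_const, Finset.card_univ, nsmul_eq_mul, mul_inv_cancel₀ hc.ne'] at hs
  linarith

lemma shannonEntropy_of_map_uniform [Nonempty α] (p : PMF Ω) (X : Ω → α)
    (h : p.map X = PMF.uniformOfFintype α) : shannonEntropy p X = Real.log (Fintype.card α) := by
  have hc : (0 : ℝ) < Fintype.card α := by exact_mod_cast Fintype.card_pos
  simp only [shannonEntropy, h, PMF.uniformOfFintype_apply, ENNReal.toReal_inv,
    ENNReal.toReal_natCast, Finset.sum_const, Finset.card_univ, nsmul_eq_mul, Real.negMulLog,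
    Real.log_inv]
  field_simp

/-- Concavity of entropy: mixing does not decrease the average entropy. -/
lemma sum_shannonEntropy_le_of_map_eq_bind {Ω' : Type} (p : PMF Ω) (X : Ω → α) (μ : PMF β)
    (p' : PMF Ω') (Y : β → Ω' → α) (h : p.map X = μ.bind fun b => p'.map (Y b)) :
    ∑ b, (μ b).toReal * shannonEntropy p' (Y b) ≤ shannonEntropy p X := by
  unfold shannonEntropy
  simp only [h, Finset.mul_sum]
  rw [Finset.sum_comm]
  refine Finset.sum_le_sum fun a _ => ?_
  have := Real.concaveOn_negMulLog.le_map_sum (t := Finset.univ) (w := fun b => (μ b).toReal)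
    (p := fun b => (p'.map (Y b) a).toReal) (fun b _ => ENNReal.toReal_nonneg)
    μ.toReal_sum_eq_one (fun b _ => ENNReal.toReal_nonneg)
  simp only [smul_eq_mul] at this
  refine this.trans (le_of_eq ?_)
  rw [PMF.bind_apply, tsum_fintype, ENNReal.toReal_sum]
  · simp only [ENNReal.toReal_mul]
  · exact fun b _ => ENNReal.mul_ne_top (μ.apply_ne_top b) ((p'.map (Y b)).apply_ne_top a)

end Entropy

/-! ### Averaging for submodular set functions (Han's inequality). -/

section Submodular

variable {ι : Type} [DecidableEq ι]

/-- Diminishing returns: the marginal value of $j$ on top of all other elements is at most its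
marginal value when elements are added one by one, and the latter telescope. -/
lemma sum_sub_erase_le_of_submodular (G : Finset ι → ℝ)
    (hsub : ∀ A a b, a ∉ A → b ∉ A → a ≠ b →
      G (insert a (insert b A)) + G A ≤ G (insert a A) + G (insert b A)) (M : Finset ι) :
    ∑ j ∈ M, (G M - G (M.erase j)) ≤ G M - G ∅ := by
  induction M using Finset.induction_on with
  | empty => simp
  | insert a M ha ih =>
    rw [Finset.sum_insert ha, Finset.erase_insert ha]
    have : ∑ j ∈ M, (G (insert a M) - G ((insert a M).erase j)) ≤
        ∑ j ∈ M, (G M - G (M.erase j)) := by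
      refine Finset.sum_le_sum fun j hj => ?_
      have haj : a ≠ j := fun h => ha (h ▸ hj)
      rw [Finset.erase_insert_of_ne haj]
      have := hsub (M.erase j) a j (fun h => ha (Finset.mem_of_mem_erase h))
        (Finset.notMem_erase j M) haj
      rw [Finset.insert_erase hj] at this
      linarith
    linarith

/-- A submodular set function has, among the `t`-subsets of a set, one with at least the
proportional share of the value of the whole set. -/
lemma exists_subset_card_of_submodular (G : Finset ι → ℝ) (h0 : 0 ≤ G ∅)
    (hsub : ∀ A a b, a ∉ A → b ∉ A → a ≠ b →
      G (insert a (insert b A)) + G A ≤ G (insert a A) + G (insert b A))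
    (t : ℕ) (M : Finset ι) (ht : t ≤ M.card) :
    ∃ J ⊆ M, J.card = t ∧ t * G M ≤ M.card * G J := by
  induction hm : M.card generalizing M with
  | zero =>
    refine ⟨M, subset_rfl, by omega, ?_⟩
    simp [show t = 0 by omega]
  | succ m ih =>
    rcases ht.eq_or_lt with rfl | hlt
    · exact ⟨M, subset_rfl, rfl, by rw [hm]⟩
    have hsum := sum_sub_erase_le_of_submodular G hsub M
    have hMne : M.Nonempty := Finset.card_pos.1 (by omega)
    -- The marginal values add up to at most $G(M)$ because $G(\emptyset)\ge0$, so some element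
    -- costs at most the average and can be dropped.
    obtain ⟨j, hj, hjle⟩ : ∃ j ∈ M, G M - G (M.erase j) ≤ G M / (m + 1 : ℕ) := by
      refine Finset.exists_le_of_sum_le hMne ?_
      rw [Finset.sum_const, hm, nsmul_eq_mul, mul_div_cancel₀ _ (by positivity)]
      linarith
    have hcard : (M.erase j).card = m := by rw [Finset.card_erase_of_mem hj, hm]; rfl
    obtain ⟨J, hJ, hJt, hle⟩ := ih (M.erase j) (by omega) hcard
    refine ⟨J, hJ.trans (Finset.erase_subset _ _), hJt, ?_⟩
    have hm1 : (0 : ℝ) < (m + 1 : ℕ) := by positivity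
    have h1 : (m : ℝ) * G M ≤ (m + 1 : ℕ) * G (M.erase j) := by
      have := mul_le_mul_of_nonneg_left hjle hm1.le
      rw [mul_div_cancel₀ _ hm1.ne'] at this
      push_cast at this ⊢
      linarith
    rcases Nat.eq_zero_or_pos m with rfl | hmp
    · have : t = 0 := by omega
      subst this
      rw [Finset.card_eq_zero.1 hJt]
      simpa using h0
    · have hmp' : (0 : ℝ) < m := by exact_mod_cast hmp
      have h2 : (m : ℝ) * (t * G M) ≤ m * ((m + 1 : ℕ) * G J) := by
        calc (m : ℝ) * (t * G M) = t * (m * G M) := by ring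
          _ ≤ t * ((m + 1 : ℕ) * G (M.erase j)) :=
            mul_le_mul_of_nonneg_left h1 (Nat.cast_nonneg t)
          _ = (m + 1 : ℕ) * (t * G (M.erase j)) := by ring
          _ ≤ (m + 1 : ℕ) * (m * G J) := mul_le_mul_of_nonneg_left hle hm1.le
          _ = m * ((m + 1 : ℕ) * G J) := by ring
      exact le_of_mul_le_mul_left h2 hmp'

end Submodular

/-! ### Marginals and product laws. -/

section BindLemmas

lemma PMF.map_fun_const {α β : Type} (μ : PMF α) (b : β) : μ.map (fun _ => b) = PMF.pure b :=
  μ.map_const b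

lemma PMF.map_fun_id {α : Type} (μ : PMF α) : μ.map (fun a => a) = μ := μ.map_id

lemma PMF.sum_map_toReal_mul {α β : Type} [Fintype α] [Fintype β] (μ : PMF α) (f : α → β)
    (F : β → ℝ) : ∑ b, (μ.map f b).toReal * F b = ∑ a, (μ a).toReal * F (f a) := by
  classical
  have h : ∀ b, (μ.map f b).toReal = ∑ a, if b = f a then (μ a).toReal else 0 := by
    intro b
    have := pmfProb_comp μ id f b
    simpa [pmfProb, PMF.map_id] using this
  simp only [h, Finset.sum_mul, ite_mul, zero_mul]
  rw [Finset.sum_comm]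
  simp

lemma PMF.bind_map_prodMk_apply {α β : Type} (μ : PMF β) (κ : β → PMF α) (a : α) (b : β) :
    (μ.bind fun b => (κ b).map fun a => (a, b)) (a, b) = μ b * κ b a := by
  classical
  rw [PMF.bind_apply, tsum_eq_single b]
  · congr 1
    rw [PMF.map_apply, tsum_eq_single a]
    · simp
    · intro a' ha'
      simp [Ne.symm ha']
  · intro b' hb'
    rw [PMF.map_apply]
    simp [Ne.symm hb']

lemma mutualInfo_eq_zero_of_map_eq {Ω α β : Type} [Fintype α] [Fintype β] (p : PMF Ω)
    (X : Ω → α) (Y : Ω → β) (μ : PMF β) (ν : PMF α)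
    (h : p.map (fun ω => (X ω, Y ω)) = μ.bind fun b => ν.map fun a => (a, b)) :
    mutualInfo p X Y = 0 := by
  have hX : p.map X = ν := by
    have := congrArg (PMF.map Prod.fst) h
    rw [PMF.map_comp, PMF.map_bind] at this
    simp only [PMF.map_comp] at this
    refine (show p.map X = _ from this).trans ?_
    simp [Function.comp_def, PMF.bind_const, PMF.map_fun_id]
  have hY : p.map Y = μ := by
    have := congrArg (PMF.map Prod.snd) h
    rw [PMF.map_comp, PMF.map_bind] at this
    simp only [PMF.map_comp] at this
    refine (show p.map Y = _ from this).trans ?_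
    simp [Function.comp_def, PMF.map_fun_const]
  refine mutualInfo_eq_zero_of_indep p X Y fun a b => ?_
  simp only [pmfProb, h, hX, hY, PMF.bind_map_prodMk_apply, ENNReal.toReal_mul]
  ring

end BindLemmas

/-! ### The converse bound. -/

namespace BSPIR

variable {N K : ℕ}

/-- The messages, the storage and the masks. -/
abbrev Scheme.Base (S : Scheme N K) : Type :=
  S.Messages × ((n : Fin N) → S.Stor n) × ((n : Fin N) → S.Mask n)

/-- The joint law of messages, storage and masks. -/
noncomputable def Scheme.base (S : Scheme N K) : PMF S.Base :=
  (PMF.uniformOfFintype S.Messages).bind fun w =>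
  (S.storage w).bind fun s => S.masking.map fun z => (w, s, z)

/-- The size of a message in nats. -/
noncomputable def Scheme.size (S : Scheme N K) : ℝ := S.L * Real.log (Fintype.card S.Sym)

lemma Scheme.size_pos (S : Scheme N K) : 0 < S.size :=
  mul_pos (by exact_mod_cast S.L_pos)
    (Real.log_pos (by exact_mod_cast Fintype.one_lt_card (α := S.Sym)))

/-- The coalition `J` whose server `n` always sends `a n`. -/
noncomputable def Byzantine.const (S : Scheme N K) {B : ℕ} (J : Finset (Fin N)) (hJ : J.card ≤ B)
    (a : (n : Fin N) → S.Ans n) : Byzantine S B where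
  servers := J
  card_le := hJ
  Aux := Unit
  aux := PMF.pure fun _ => ()
  respond := fun n _ _ _ _ => a n

/-- No server is Byzantine. -/
noncomputable def Byzantine.none (S : Scheme N K) (B : ℕ) : Byzantine S B where
  servers := ∅
  card_le := by simp
  Aux := Unit
  aux := PMF.pure fun _ => ()
  respond := fun n => absurd n.2 (Finset.notMem_empty _)

/-- The honest answers of the servers in `J` to the queries `q`. -/
def Scheme.answers (S : Scheme N K) (J : Finset (Fin N)) (q : (n : J) → S.Que n) (ω : S.Base) :
    (n : J) → S.Ans n :=
  fun n => S.answer n (ω.2.1 n) (q n) (ω.2.2 n)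

/-- The honest answer of server `n` to the query `q`. -/
def Scheme.answer₁ (S : Scheme N K) (n : Fin N) (q : S.Que n) (ω : S.Base) : S.Ans n :=
  S.answer n (ω.2.1 n) q (ω.2.2 n)

/-- The side information: the first `k` messages, the storage of the servers in `I`, the masks. -/
def Scheme.side (S : Scheme N K) (I : Finset (Fin N)) (k : ℕ) (ω : S.Base) :
    ({j : Fin K // (j : ℕ) < k} → Fin S.L → S.Sym) × ((n : I) → S.Stor n) ×
      ((n : Fin N) → S.Mask n) :=
  (fun j => ω.1 j, fun n => ω.2.1 n, ω.2.2)

/-- The conditional entropy of the answers of the servers in `J` to fixed queries, given the side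
information. -/
noncomputable def Scheme.condEnt (S : Scheme N K) (I : Finset (Fin N)) (k : ℕ)
    (J : Finset (Fin N)) (q : (n : J) → S.Que n) : ℝ :=
  shannonEntropy S.base (fun ω => (S.answers J q ω, S.side I k ω)) -
    shannonEntropy S.base (S.side I k)

/-- The average of `condEnt` over the queries for the index `θ`. -/
noncomputable def Scheme.avgCondEnt (S : Scheme N K) (I : Finset (Fin N)) (k : ℕ) (θ : Fin K)
    (J : Finset (Fin N)) : ℝ :=
  ∑ q, (S.query θ q).toReal * S.condEnt I k J (fun n => q n)

lemma lawGiven_none (S : Scheme N K) (B : ℕ) (θ : Fin K) :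
    lawGiven S (Byzantine.none S B) θ = S.base.bind fun ω => (S.query θ).map fun q =>
      ⟨θ, ω.1, ω.2.1, ω.2.2, q, fun n => S.answer₁ n (q n) ω⟩ := by
  have h : ∀ s q z γ, received S (Byzantine.none S B) s q z γ =
      fun n => S.answer n (s n) (q n) (z n) := by
    intro s q z γ
    funext n
    exact dif_neg (Finset.notMem_empty n)
  simp only [lawGiven, Scheme.base, PMF.bind_bind, h, PMF.pure_bind, PMF.bind_const,
    PMF.map, Function.comp_def, Scheme.answer₁]

lemma law_none_map_stor_W [NeZero K] (S : Scheme N K) (B : ℕ) (I : Finset (Fin N)) :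
    (law S (Byzantine.none S B)).map (fun ω => (ω.stor I, ω.W)) =
      S.base.map (fun ω => ((fun n : I => ω.2.1 n), ω.1)) := by
  have h : ∀ ω : Outcome S, ω.stor I = fun n : I => ω.S n := fun _ => rfl
  simp only [law, lawGiven_none, PMF.map_bind, PMF.map_comp, Function.comp_def, h,
    PMF.map_fun_const, PMF.bind_const]
  rfl

lemma law_none_map_que [NeZero K] (S : Scheme N K) (B : ℕ) (I : Finset (Fin N)) :
    (law S (Byzantine.none S B)).map (fun ω => (ω.que I, ω.θ)) =
      (PMF.uniformOfFintype (Fin K)).bind fun θ =>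
        ((S.query θ).map fun q => (fun n : I => q n)).map fun a => (a, θ) := by
  have h : ∀ ω : Outcome S, ω.que I = fun n : I => ω.Q n := fun _ => rfl
  simp only [law, lawGiven_none, PMF.map_bind, PMF.map_comp, Function.comp_def, h, PMF.bind_const]

lemma law_none_map_ans [NeZero K] (S : Scheme N K) (B : ℕ) (n : Fin N) :
    (law S (Byzantine.none S B)).map (fun ω => ω.A n) =
      ((PMF.uniformOfFintype (Fin K)).bind S.query).bind fun q =>
        S.base.map (S.answer₁ n (q n)) := by
  simp only [law, lawGiven_none, PMF.map_bind, PMF.map_comp, Function.comp_def, PMF.bind_bind]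
  congr 1
  funext θ
  exact PMF.bind_comm S.base (S.query θ) fun ω q => PMF.pure (S.answer₁ n (q n) ω)

variable {S : Scheme N K} {B T E X : ℕ}

/-- The queries to at most `B` servers have the same law for all indices. -/
lemma IsValid.query_map_eq [NeZero K] (hS : IsValid S B T E X) (J : Finset (Fin N))
    (hJ : J.card ≤ B) (θ θ' : Fin K) :
    (S.query θ).map (fun q => (fun n : J => q n)) =
      (S.query θ').map (fun q => (fun n : J => q n)) := by
  have hMI := hS.byzantine_private (Byzantine.none S B) J hJ
  have key : ∀ (θ : Fin K) a, ((S.query θ).map (fun q => (fun n : J => q n)) a).toReal =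
      pmfProb (law S (Byzantine.none S B)) (Outcome.que J) a := by
    intro θ a
    have h := indep_of_mutualInfo_eq_zero _ _ _ hMI a θ
    have hθ : pmfProb (law S (Byzantine.none S B)) Outcome.θ θ = (K : ℝ)⁻¹ := by
      have : (law S (Byzantine.none S B)).map Outcome.θ = PMF.uniformOfFintype (Fin K) := by
        have := congrArg (PMF.map Prod.snd) (law_none_map_que S B J)
        rw [PMF.map_comp, PMF.map_bind] at this
        simp only [PMF.map_comp] at this
        refine (show (law S (Byzantine.none S B)).map Outcome.θ = _ from this).trans ?_
        simp [Function.comp_def, PMF.map_fun_const]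
      simp [pmfProb, this]
    have hK : (K : ℝ) ≠ 0 := by exact_mod_cast NeZero.ne K
    rw [hθ, pmfProb, law_none_map_que, PMF.bind_map_prodMk_apply] at h
    simp only [PMF.uniformOfFintype_apply, Fintype.card_fin, ENNReal.toReal_mul,
      ENNReal.toReal_inv, ENNReal.toReal_natCast] at h
    field_simp at h
    exact h
  ext a
  exact (ENNReal.toReal_eq_toReal_iff' (PMF.apply_ne_top _ _) (PMF.apply_ne_top _ _)).1
    ((key θ a).trans (key θ' a).symm)

/-- Constant lies suffice for the converse: a coalition that guesses blindly hits any prescribed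
wrong answers, and errorless decoding must survive every outcome of positive probability. -/
lemma mem_support_lawGiven_const {J : Finset (Fin N)} (hJ : J.card ≤ B)
    (a : (n : Fin N) → S.Ans n) {k : Fin K} {ω : S.Base} (hω : ω ∈ S.base.support)
    {q : (n : Fin N) → S.Que n} (hq : q ∈ (S.query k).support) :
    (⟨k, ω.1, ω.2.1, ω.2.2, q, fun n => if n ∈ J then a n else S.answer₁ n (q n) ω⟩ : Outcome S) ∈
      (lawGiven S (Byzantine.const S J hJ a) k).support := by
  obtain ⟨w, s, z⟩ := ω
  simp only [Scheme.base, PMF.mem_support_bind_iff, PMF.mem_support_map_iff, Prod.mk.injEq] at hω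
  obtain ⟨w', -, s', hs, z', hz, rfl, rfl, rfl⟩ := hω
  simp only [lawGiven, PMF.mem_support_bind_iff]
  refine ⟨w', by simp, s', hs, z', hz, q, hq, fun _ => (),
    (PMF.mem_support_pure_iff _ _).2 rfl, ?_⟩
  rw [PMF.mem_support_pure_iff]
  congr 1

/-- The honest answers of all but `2B` servers determine the required message. -/
lemma IsValid.determined [NeZero K] (hS : IsValid S B T E X) {k : Fin K}
    {q : (n : Fin N) → S.Que n} (hq : q ∈ (S.query k).support) {ω ω' : S.Base}
    (hω : ω ∈ S.base.support) (hω' : ω' ∈ S.base.support) (M : Finset (Fin N))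
    (hM : Mᶜ.card ≤ 2 * B) (h : ∀ n ∈ M, S.answer₁ n (q n) ω = S.answer₁ n (q n) ω') :
    ω.1 k = ω'.1 k := by
  -- The complement of `M` is cut into two coalitions. In state `ω` the servers of `J` imitate `ω'`;
  -- in state `ω'` the remaining ones imitate `ω`. The user receives the same answers and must
  -- decode both messages.
  obtain ⟨J, hJM, hJ⟩ := Finset.exists_subset_card_eq (min_le_right B Mᶜ.card)
  have hJ1 : J.card ≤ B := hJ ▸ min_le_left _ _
  have hJ2 : (Mᶜ \ J).card ≤ B := by
    rw [Finset.card_sdiff_of_subset hJM, hJ]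
    omega
  have h1 := hS.correct _ k _ (mem_support_lawGiven_const hJ1
    (fun n => S.answer₁ n (q n) ω') hω hq)
  have h2 := hS.correct _ k _ (mem_support_lawGiven_const hJ2
    (fun n => S.answer₁ n (q n) ω) hω' hq)
  dsimp only at h1 h2
  rw [← h1, ← h2]
  congr 1
  funext n
  by_cases hn : n ∈ M
  · simp [hn, h n hn, show n ∉ J from fun hJ' => by simpa [hn] using hJM hJ']
  · by_cases hnJ : n ∈ J <;> simp [hn, hnJ]

lemma log_card_words (S : Scheme N K) (ι : Type) [Fintype ι] [DecidableEq ι] :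
    Real.log (Fintype.card (ι → Fin S.L → S.Sym)) = Fintype.card ι * S.size := by
  simp [Scheme.size, Fintype.card_pi, Real.log_pow]

/-- Given the storage of at most `B` servers and the masks, each message has full entropy. -/
lemma IsValid.side_entropy_succ [NeZero K] (hS : IsValid S B T E X) (I : Finset (Fin N))
    (hI : I.card ≤ B) (k : Fin K) :
    shannonEntropy S.base (S.side I k) + S.size ≤ shannonEntropy S.base (S.side I (k + 1)) := by
  set HS := shannonEntropy S.base (fun ω => (fun n : I => ω.2.1 n))
  set HZ := shannonEntropy S.base (fun ω => ω.2.2)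
  have hW : shannonEntropy S.base (fun ω => ω.1) = K * S.size := by
    rw [shannonEntropy_of_map_uniform, log_card_words, Fintype.card_fin]
    simp [Scheme.base, PMF.map_bind, PMF.map_comp, Function.comp_def, PMF.map_fun_const]
  have hSW : shannonEntropy S.base (fun ω => ((fun n : I => ω.2.1 n), ω.1)) = HS + K * S.size := by
    have h0 := hS.byzantine_secure (Byzantine.none S B) I hI
    have h1 := law_none_map_stor_W S B I
    have h2 := congrArg (PMF.map Prod.fst) h1
    have h3 := congrArg (PMF.map Prod.snd) h1
    rw [PMF.map_comp, PMF.map_comp] at h2 h3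
    have : mutualInfo S.base (fun ω => (fun n : I => ω.2.1 n)) (fun ω => ω.1) = 0 := by
      rw [← h0]
      unfold mutualInfo shannonEntropy
      rw [h1]
      congr 2
      · exact congrArg (fun μ : PMF _ => ∑ a, Real.negMulLog (μ a).toReal) h2.symm
      · exact congrArg (fun μ : PMF _ => ∑ a, Real.negMulLog (μ a).toReal) h3.symm
    rw [mutualInfo, hW] at this
    linarith
  have hfull : shannonEntropy S.base (fun ω => (ω.2.2, ((fun n : I => ω.2.1 n), ω.1))) =
      HZ + (HS + K * S.size) := by
    have : mutualInfo S.base (fun ω => ω.2.2) (fun ω => ((fun n : I => ω.2.1 n), ω.1)) = 0 := by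
      refine mutualInfo_eq_zero_of_map_eq _ _ _
        ((PMF.uniformOfFintype S.Messages).bind fun w => (S.storage w).map fun s =>
          ((fun n : I => s n), w)) S.masking ?_
      simp only [Scheme.base, PMF.map_bind, PMF.map_comp, Function.comp_def, PMF.bind_bind,
        PMF.bind_map]
    rw [mutualInfo, hSW] at this
    linarith
  have hk : Fintype.card {j : Fin K // (j : ℕ) < k} = k := by
    rw [Fintype.card_subtype]
    rw [← Fin.card_Iio k]
    congr 1
    ext j
    simp
  have hk' : Fintype.card {j : Fin K // k < j} = K - 1 - k := by
    rw [Fintype.card_subtype]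
    rw [← Fin.card_Ioi k]
    congr 1
    ext j
    simp
  -- Two one-sided bounds are enough: subadditivity from above for `k` known messages, and from
  -- below for `k + 1`, where the `K - 1 - k` missing messages account for at most their full size
  -- in the total entropy.
  have u1 : shannonEntropy S.base (S.side I k) ≤ k * S.size + (HS + HZ) := by
    refine (shannonEntropy_pair_le S.base (fun ω => fun j : {j : Fin K // (j : ℕ) < k} => ω.1 j)
      (fun ω => ((fun n : I => ω.2.1 n), ω.2.2))).trans (add_le_add ?_ ?_)
    · refine (shannonEntropy_le_log_card _ _).trans ?_
      rw [log_card_words, hk]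
    · exact shannonEntropy_pair_le S.base _ _
  have u2 : HZ + (HS + K * S.size) ≤
      shannonEntropy S.base (S.side I (k + 1)) + ((K - 1 - k : ℕ) : ℝ) * S.size := by
    rw [← hfull]
    refine (shannonEntropy_le_of_determines S.base (fun ω => (S.side I (k + 1) ω,
      (fun j : {j : Fin K // k < j} => ω.1 j))) _ ?_).trans
      ((shannonEntropy_pair_le S.base _ _).trans (add_le_add le_rfl ?_))
    · intro ω _ ω' _ hωω
      simp only [Scheme.side, Prod.mk.injEq] at hωω ⊢
      obtain ⟨⟨h1, h2, h3⟩, h4⟩ := hωω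
      refine ⟨h3, h2, ?_⟩
      funext j
      rcases lt_or_ge k j with hj | hj
      · exact congrFun h4 ⟨j, hj⟩
      · exact congrFun h1 ⟨j, Nat.lt_succ_of_le hj⟩
    · refine (shannonEntropy_le_log_card _ _).trans ?_
      rw [log_card_words, hk']
  have hcast : ((K - 1 - k : ℕ) : ℝ) = K - 1 - k := by
    have := k.2
    rw [Nat.cast_sub (by omega), Nat.cast_sub (by omega)]
    simp
  rw [hcast] at u2
  nlinarith

/-- The storage of `I` and the masks give the answers of `I`, so with those of `M` message `k` is
determined. Adding it to the side information leaves the joint entropy unincreased, while the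
entropy of the side information grows by a whole message. -/
lemma IsValid.condEnt_succ_le [NeZero K] (hS : IsValid S B T E X) {I M : Finset (Fin N)}
    (hI : I.card ≤ B) (hM : (M ∪ I)ᶜ.card ≤ 2 * B) (k : Fin K) {q : (n : Fin N) → S.Que n}
    (hq : q ∈ (S.query k).support) :
    S.size + S.condEnt I (k + 1) M (fun n => q n) ≤ S.condEnt I k M (fun n => q n) := by
  have h1 := hS.side_entropy_succ I hI k
  have h2 : shannonEntropy S.base (fun ω => (S.answers M (fun n => q n) ω, S.side I (k + 1) ω)) ≤
      shannonEntropy S.base (fun ω => (S.answers M (fun n => q n) ω, S.side I k ω)) := by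
    refine shannonEntropy_le_of_determines _ _ _ fun ω hω ω' hω' h => ?_
    simp only [Scheme.side, Prod.mk.injEq] at h ⊢
    obtain ⟨ha, hw, hs, hz⟩ := h
    refine ⟨ha, ?_, hs, hz⟩
    have hWk : ω.1 k = ω'.1 k := by
      refine hS.determined hq hω hω' (M ∪ I) hM fun n hn => ?_
      rcases Finset.mem_union.1 hn with hn | hn
      · exact congrFun ha ⟨n, hn⟩
      · have := congrFun hs ⟨n, hn⟩
        dsimp only at this
        simp only [Scheme.answer₁, this, hz]
    funext j
    rcases (Nat.lt_succ_iff.1 j.2).lt_or_eq with hj | hj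
    · exact congrFun hw ⟨j, hj⟩
    · rw [show (j : Fin K) = k from Fin.ext hj, hWk]
  unfold Scheme.condEnt
  linarith

lemma sum_query (S : Scheme N K) (θ : Fin K) : ∑ q, (S.query θ q).toReal = 1 :=
  (S.query θ).toReal_sum_eq_one

lemma IsValid.avgCondEnt_succ_le [NeZero K] (hS : IsValid S B T E X) {I M : Finset (Fin N)}
    (hI : I.card ≤ B) (hM : (M ∪ I)ᶜ.card ≤ 2 * B) (k : Fin K) :
    S.size + S.avgCondEnt I (k + 1) k M ≤ S.avgCondEnt I k k M := by
  unfold Scheme.avgCondEnt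
  rw [← one_mul S.size, ← sum_query S k, Finset.sum_mul, ← Finset.sum_add_distrib]
  refine Finset.sum_le_sum fun q _ => ?_
  rw [← mul_add]
  by_cases hq : q ∈ (S.query k).support
  · exact mul_le_mul_of_nonneg_left (hS.condEnt_succ_le hI hM k hq) ENNReal.toReal_nonneg
  · rw [PMF.mem_support_iff, not_not] at hq
    simp [hq]

lemma condEnt_nonneg (S : Scheme N K) (I : Finset (Fin N)) (k : ℕ) (J : Finset (Fin N))
    (q : (n : J) → S.Que n) : 0 ≤ S.condEnt I k J q :=
  sub_nonneg.2 (shannonEntropy_comp_le S.base (fun ω => (S.answers J q ω, S.side I k ω)) Prod.snd)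

lemma condEnt_mono (S : Scheme N K) (I : Finset (Fin N)) (k : ℕ) {J M : Finset (Fin N)}
    (hJM : J ⊆ M) (q : (n : Fin N) → S.Que n) :
    S.condEnt I k J (fun n => q n) ≤ S.condEnt I k M (fun n => q n) := by
  refine sub_le_sub_right (shannonEntropy_le_of_determines _ _ _ fun ω _ ω' _ h => ?_) _
  simp only [Prod.mk.injEq] at h ⊢
  exact ⟨funext fun n => congrFun h.1 ⟨n, hJM n.2⟩, h.2⟩

lemma answers_insert_eq_iff (S : Scheme N K) (J : Finset (Fin N)) (a : Fin N)
    (q : (n : Fin N) → S.Que n) (ω ω' : S.Base) :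
    S.answers (insert a J) (fun n => q n) ω = S.answers (insert a J) (fun n => q n) ω' ↔
      S.answer₁ a (q a) ω = S.answer₁ a (q a) ω' ∧
        S.answers J (fun n => q n) ω = S.answers J (fun n => q n) ω' := by
  constructor
  · intro h
    exact ⟨congrFun h ⟨a, Finset.mem_insert_self a J⟩,
      funext fun n => congrFun h ⟨n, Finset.mem_insert_of_mem n.2⟩⟩
  · rintro ⟨h1, h2⟩
    funext ⟨n, hn⟩
    rcases Finset.mem_insert.1 hn with rfl | hn'
    · exact h1
    · exact congrFun h2 ⟨n, hn'⟩

lemma condEnt_submodular (S : Scheme N K) (I : Finset (Fin N)) (k : ℕ) (A : Finset (Fin N))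
    (a b : Fin N) (q : (n : Fin N) → S.Que n) :
    S.condEnt I k (insert a (insert b A)) (fun n => q n) + S.condEnt I k A (fun n => q n) ≤
      S.condEnt I k (insert a A) (fun n => q n) + S.condEnt I k (insert b A) (fun n => q n) := by
  have h := shannonEntropy_submodular S.base (S.answer₁ a (q a)) (S.answer₁ b (q b))
    (fun ω => (S.answers A (fun n => q n) ω, S.side I k ω))
  have e : ∀ c, shannonEntropy S.base (fun ω => (S.answer₁ c (q c) ω,
      (S.answers A (fun n => q n) ω, S.side I k ω))) = shannonEntropy S.base
        (fun ω => (S.answers (insert c A) (fun n => q n) ω, S.side I k ω)) := by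
    refine fun c => shannonEntropy_congr _ _ _ fun ω ω' => ?_
    simp only [Prod.mk.injEq, answers_insert_eq_iff, and_assoc]
  have e2 : shannonEntropy S.base (fun ω => (S.answer₁ a (q a) ω, S.answer₁ b (q b) ω,
      (S.answers A (fun n => q n) ω, S.side I k ω))) = shannonEntropy S.base
        (fun ω => (S.answers (insert a (insert b A)) (fun n => q n) ω, S.side I k ω)) := by
    refine shannonEntropy_congr _ _ _ fun ω ω' => ?_
    simp only [Prod.mk.injEq, answers_insert_eq_iff, and_assoc]
  rw [e, e, e2] at h
  unfold Scheme.condEnt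
  linarith

lemma avgCondEnt_nonneg (S : Scheme N K) (I : Finset (Fin N)) (k : ℕ) (θ : Fin K)
    (J : Finset (Fin N)) : 0 ≤ S.avgCondEnt I k θ J :=
  Finset.sum_nonneg fun _ _ => mul_nonneg ENNReal.toReal_nonneg (condEnt_nonneg _ _ _ _ _)

lemma avgCondEnt_mono (S : Scheme N K) (I : Finset (Fin N)) (k : ℕ) (θ : Fin K)
    {J M : Finset (Fin N)} (hJM : J ⊆ M) : S.avgCondEnt I k θ J ≤ S.avgCondEnt I k θ M :=
  Finset.sum_le_sum fun q _ =>
    mul_le_mul_of_nonneg_left (condEnt_mono S I k hJM q) ENNReal.toReal_nonneg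

lemma IsValid.sum_query_eq [NeZero K] (hS : IsValid S B T E X) {J : Finset (Fin N)}
    (hJ : J.card ≤ B) (θ θ' : Fin K) (F : ((n : J) → S.Que n) → ℝ) :
    ∑ q, (S.query θ q).toReal * F (fun n => q n) = ∑ q, (S.query θ' q).toReal * F (fun n => q n) := by
  rw [← PMF.sum_map_toReal_mul (S.query θ) (fun q => (fun n : J => q n)) F,
    ← PMF.sum_map_toReal_mul (S.query θ') (fun q => (fun n : J => q n)) F,
    hS.query_map_eq J hJ θ θ']

/-- Some `B` servers of `M` carry a proportional share of the entropy for `θ'`. The law of their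
queries is the same for `θ`, so their share is the same too and bounds the value of `M` from below.
-/
lemma IsValid.avgCondEnt_index [NeZero K] (hS : IsValid S B T E X) (I : Finset (Fin N)) (k : ℕ)
    {M : Finset (Fin N)} (hM : B ≤ M.card) (θ θ' : Fin K) :
    B * S.avgCondEnt I k θ' M ≤ M.card * S.avgCondEnt I k θ M := by
  obtain ⟨J, hJM, hJ, h⟩ := exists_subset_card_of_submodular (S.avgCondEnt I k θ')
    (avgCondEnt_nonneg _ _ _ _ _) (fun A a b _ _ _ => by
      unfold Scheme.avgCondEnt
      simp only [← Finset.sum_add_distrib, ← mul_add]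
      exact Finset.sum_le_sum fun q _ =>
        mul_le_mul_of_nonneg_left (condEnt_submodular S I k A a b q) ENNReal.toReal_nonneg) B M hM
  refine h.trans (mul_le_mul_of_nonneg_left ?_ (Nat.cast_nonneg _))
  have : S.avgCondEnt I k θ' J = S.avgCondEnt I k θ J := hS.sum_query_eq hJ.le θ' θ _
  rw [this]
  exact avgCondEnt_mono S I k θ hJM

/-- The recursion over the messages. -/
lemma IsValid.geom_le_avgCondEnt [NeZero K] (hS : IsValid S B T E X) {I M : Finset (Fin N)}
    (hI : I.card ≤ B) (hM : (M ∪ I)ᶜ.card ≤ 2 * B) (hBM : B ≤ M.card) (hM0 : 0 < M.card)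
    (d : ℕ) (k : Fin K) (hk : k + (d + 1) = K) :
    S.size * ∑ i ∈ Finset.range (d + 1), ((B : ℝ) / M.card) ^ i ≤ S.avgCondEnt I k k M := by
  induction d generalizing k with
  | zero =>
    have := hS.avgCondEnt_succ_le hI hM k
    have := avgCondEnt_nonneg S I (k + 1) k M
    simp
    linarith
  | succ d ih =>
    -- Here `k` is at once the required index and the number of known messages. Decoding raises the
    -- second to `k + 1`; `h3` then raises the index, at the cost of the factor `B / M.card`.
    have h1 := hS.avgCondEnt_succ_le hI hM k
    have h2 := ih ⟨k + 1, by omega⟩ (by simp; omega)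
    have h3 := hS.avgCondEnt_index I (k + 1) hBM k ⟨k + 1, by omega⟩
    have hM0' : (0 : ℝ) < M.card := by exact_mod_cast hM0
    have h4 : (B : ℝ) / M.card * S.avgCondEnt I (k + 1) ⟨k + 1, by omega⟩ M ≤
        S.avgCondEnt I (k + 1) k M := by
      rw [div_mul_eq_mul_div, div_le_iff₀ hM0']
      linarith
    have h5 : (0 : ℝ) ≤ (B : ℝ) / M.card := by positivity
    have h6 := mul_le_mul_of_nonneg_left h2 h5
    rw [geom_sum_succ]
    simp only at h6
    nlinarith

/-- The average entropy of the answer of an honest server for the index `θ`. -/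
noncomputable def Scheme.avgEnt (S : Scheme N K) (θ : Fin K) (n : Fin N) : ℝ :=
  ∑ q, (S.query θ q).toReal * shannonEntropy S.base (S.answer₁ n (q n))

lemma entropy_answers_le (S : Scheme N K) (J : Finset (Fin N)) (q : (n : Fin N) → S.Que n) :
    shannonEntropy S.base (S.answers J (fun n => q n)) ≤
      ∑ n ∈ J, shannonEntropy S.base (S.answer₁ n (q n)) := by
  induction J using Finset.induction_on with
  | empty =>
    rw [Finset.sum_empty, ← shannonEntropy_unit S.base]
    exact shannonEntropy_le_of_determines _ _ _ fun ω _ ω' _ _ =>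
      funext fun n => absurd n.2 (Finset.notMem_empty _)
  | insert a J ha ih =>
    rw [Finset.sum_insert ha]
    refine le_trans ?_ (add_le_add le_rfl ih)
    refine le_trans (shannonEntropy_le_of_determines _ _ _ fun ω _ ω' _ h => ?_)
      (shannonEntropy_pair_le S.base _ _)
    rw [answers_insert_eq_iff]
    simpa using h

lemma avgCondEnt_le_sum (S : Scheme N K) (I : Finset (Fin N)) (k : ℕ) (θ : Fin K)
    (J : Finset (Fin N)) : S.avgCondEnt I k θ J ≤ ∑ n ∈ J, S.avgEnt θ n := by
  unfold Scheme.avgCondEnt Scheme.avgEnt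
  rw [Finset.sum_comm]
  simp only [← Finset.mul_sum]
  refine Finset.sum_le_sum fun q _ => mul_le_mul_of_nonneg_left ?_ ENNReal.toReal_nonneg
  have h1 := shannonEntropy_pair_le S.base (S.answers J (fun n => q n)) (S.side I k)
  have h2 := entropy_answers_le S J q
  unfold Scheme.condEnt
  linarith

/-- The law of a received answer is a mixture, over index and queries, of its laws for fixed
queries, and entropy is concave. -/
lemma avg_avgEnt_le [NeZero K] (S : Scheme N K) (B : ℕ) (n : Fin N) :
    ∑ θ, (K : ℝ)⁻¹ * S.avgEnt θ n ≤
      shannonEntropy (law S (Byzantine.none S B)) (fun ω => ω.A n) := by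
  refine le_trans (le_of_eq ?_) (sum_shannonEntropy_le_of_map_eq_bind _ _ _ _ _
    (law_none_map_ans S B n))
  have : ∀ q, (((PMF.uniformOfFintype (Fin K)).bind S.query) q).toReal =
      ∑ θ, (K : ℝ)⁻¹ * (S.query θ q).toReal := by
    intro q
    rw [PMF.bind_apply, tsum_fintype, ENNReal.toReal_sum]
    · simp
    · exact fun θ _ => ENNReal.mul_ne_top (PMF.apply_ne_top _ _) (PMF.apply_ne_top _ _)
  simp only [this, Finset.sum_mul, Scheme.avgEnt, Finset.mul_sum]
  rw [Finset.sum_comm]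
  simp only [mul_assoc]

/-- The converse: a lower bound on the download of any valid scheme. -/
theorem IsValid.download_ge [NeZero K] (hS : IsValid S B T E X) (hN : 0 < N) (hB : 4 * B ≤ N) :
    N * (S.size * ∑ i ∈ Finset.range K, ((B : ℝ) / (N - 3 * B : ℕ)) ^ i) ≤
      (N - 3 * B : ℕ) *
        ∑ n, shannonEntropy (law S (Byzantine.none S B)) (fun ω => ω.A n) := by
  set h : Fin N → ℝ := fun n => shannonEntropy (law S (Byzantine.none S B)) (fun ω => ω.A n)
  have hK : 0 < K := Nat.pos_of_ne_zero (NeZero.ne K)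
  have hK' : (K : ℝ) ≠ 0 := by exact_mod_cast NeZero.ne K
  -- Applied to the negative of an additive function, the averaging lemma selects servers whose
  -- download is at most proportional.
  obtain ⟨M, -, hM, hle⟩ := exists_subset_card_of_submodular (fun J => -∑ n ∈ J, h n) (by simp)
    (fun A a b ha hb hab => by
      rw [Finset.sum_insert (by simp [ha, hab]), Finset.sum_insert hb, Finset.sum_insert ha]
      linarith) (N - 3 * B) Finset.univ (by simp)
  rw [Finset.card_univ, Fintype.card_fin] at hle
  have hMc : Mᶜ.card = 3 * B := by rw [Finset.card_compl, hM, Fintype.card_fin]; omega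
  obtain ⟨I, hIM, hI⟩ := Finset.exists_subset_card_eq (show B ≤ Mᶜ.card by omega)
  have hMI : (M ∪ I)ᶜ.card ≤ 2 * B := by
    rw [Finset.compl_union, ← Finset.sdiff_eq_inter_compl, Finset.card_sdiff_of_subset hIM]
    omega
  have hM0 : 0 < M.card := by omega
  have hsumM : S.size * ∑ i ∈ Finset.range K, ((B : ℝ) / (N - 3 * B : ℕ)) ^ i ≤ ∑ n ∈ M, h n := by
    have h1 : ∀ θ : Fin K, S.size * ∑ i ∈ Finset.range K, ((B : ℝ) / (N - 3 * B : ℕ)) ^ i ≤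
        ∑ n ∈ M, S.avgEnt θ n := by
      intro θ
      -- For `B = 0` not even a single query need be private, so indices cannot be exchanged. But
      -- then the geometric sum is its first term ($0^0=1$), and decoding one message suffices for
      -- each index.
      rcases Nat.eq_zero_or_pos B with rfl | hBpos
      · have e : ∑ i ∈ Finset.range K, (((0 : ℕ) : ℝ) / (N - 3 * 0 : ℕ)) ^ i = 1 := by
          obtain ⟨d, rfl⟩ : ∃ d, K = d + 1 := ⟨K - 1, by omega⟩
          simp [geom_sum_succ]
        rw [e]
        have a1 := hS.avgCondEnt_succ_le hI.le hMI θ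
        have a2 := avgCondEnt_nonneg S I (θ + 1) θ M
        have a3 := avgCondEnt_le_sum S I θ θ M
        linarith
      · obtain ⟨d, rfl⟩ : ∃ d, K = d + 1 := ⟨K - 1, by omega⟩
        have a1 := hS.geom_le_avgCondEnt hI.le hMI (by omega) hM0 d 0 (by simp)
        rw [hM] at a1
        refine a1.trans ((avgCondEnt_le_sum S I _ _ M).trans (Finset.sum_le_sum fun n _ => ?_))
        -- The recursion starts at index 0; since `1 ≤ B`, the average entropy of a single answer
        -- does not depend on the index.
        exact (hS.sum_query_eq (J := {n}) (by simp; omega) 0 θ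
          (fun q => shannonEntropy S.base (S.answer₁ n (q ⟨n, by simp⟩)))).le
    calc _ = ∑ θ : Fin K, (K : ℝ)⁻¹ *
          (S.size * ∑ i ∈ Finset.range K, ((B : ℝ) / (N - 3 * B : ℕ)) ^ i) := by
          rw [Finset.sum_const, Finset.card_univ, Fintype.card_fin, nsmul_eq_mul,
            mul_inv_cancel_left₀ hK']
      _ ≤ ∑ θ : Fin K, (K : ℝ)⁻¹ * ∑ n ∈ M, S.avgEnt θ n :=
          Finset.sum_le_sum fun θ _ => mul_le_mul_of_nonneg_left (h1 θ) (by positivity)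
      _ = ∑ n ∈ M, ∑ θ : Fin K, (K : ℝ)⁻¹ * S.avgEnt θ n := by
          simp only [Finset.mul_sum]
          rw [Finset.sum_comm]
      _ ≤ _ := Finset.sum_le_sum fun n _ => avg_avgEnt_le S B n
  have hNn : (0 : ℝ) ≤ N := Nat.cast_nonneg N
  have := mul_le_mul_of_nonneg_left hsumM hNn
  linarith

end BSPIR

/-! ### Independence from translation invariance. -/

lemma PMF.uniformOfFintype_bind_add {A α : Type} [Fintype A] [AddGroup A] (c : A)
    (g : A → PMF α) :
    (PMF.uniformOfFintype A).bind g = (PMF.uniformOfFintype A).bind fun x => g (x + c) := by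
  ext y
  rw [PMF.bind_apply, PMF.bind_apply, tsum_fintype, tsum_fintype]
  simp only [PMF.uniformOfFintype_apply]
  exact (Equiv.sum_comp (Equiv.addRight c) fun x => (Fintype.card A : ℝ≥0∞)⁻¹ * g x y).symm

/-- If the joint law of `X` and `Y` is invariant under transformations of `Y` that act
transitively on its values, then `I(X;Y) = 0`. -/
lemma mutualInfo_eq_zero_of_transitive {Ω α β : Type} [Fintype α] [Fintype β] (p : PMF Ω)
    (X : Ω → α) (Y : Ω → β)
    (h : ∀ b b', ∃ e : β → β, e.Injective ∧ e b = b' ∧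
      p.map (fun ω => (X ω, e (Y ω))) = p.map (fun ω => (X ω, Y ω))) :
    mutualInfo p X Y = 0 := by
  classical
  refine mutualInfo_eq_zero_of_const p X Y fun a b b' => ?_
  obtain ⟨e, he, rfl, hp⟩ := h b b'
  rw [← hp]
  have hcomp : p.map (fun ω => (X ω, e (Y ω))) =
      (p.map (fun ω => (X ω, Y ω))).map (Prod.map id e) := by rw [PMF.map_comp]; rfl
  have hinj : (Prod.map (id : α → α) e).Injective := Function.injective_id.prodMap he
  have hval : p.map (fun ω => (X ω, e (Y ω))) (a, e b) =
      p.map (fun ω => (X ω, Y ω)) (a, b) := by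
    rw [hcomp, show ((a, e b) : α × β) = Prod.map id e (a, b) from rfl, PMF.map_apply,
      tsum_eq_single (a, b)]
    · simp
    · intro v hv
      rw [if_neg fun heq => hv (hinj heq).symm]
  rw [hval, hp]

namespace BSPIR

open Polynomial

/-! ### Secret sharing by polynomials over a field. -/

section Polynomials

variable {F : Type} [Field F]

instance [Finite F] (n : ℕ) : Finite (degreeLT F n) :=
  Finite.of_equiv _ (degreeLTEquiv F n).symm.toEquiv

noncomputable instance [Finite F] (n : ℕ) : Fintype (degreeLT F n) := Fintype.ofFinite _

/-- The polynomial of degree at most `B` with value `c` at `y` and randomness `R`. -/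
noncomputable def sharePoly {B : ℕ} (y c : F) (R : degreeLT F B) : F[X] :=
  C c + (X - C y) * R.1

lemma eval_sharePoly {B : ℕ} (y c : F) (R : degreeLT F B) (x : F) :
    (sharePoly y c R).eval x = c + (x - y) * R.1.eval x := by
  simp [sharePoly]

lemma eval_sharePoly_self {B : ℕ} (y c : F) (R : degreeLT F B) :
    (sharePoly y c R).eval y = c := by
  simp [sharePoly]

lemma degree_sharePoly_lt {B : ℕ} (y c : F) (R : degreeLT F B) :
    (sharePoly y c R).degree < (B + 1 : ℕ) := by
  refine (degree_add_le _ _).trans_lt (max_lt (degree_C_le.trans_lt ?_) ?_)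
  · exact_mod_cast Nat.succ_pos B
  · have h := mem_degreeLT.1 R.2
    rw [degree_mul, degree_X_sub_C]
    rcases eq_or_ne R.1 0 with h0 | h0
    · rw [h0]
      simp
    · rw [degree_eq_natDegree h0] at h ⊢
      norm_cast at h ⊢
      omega

lemma degree_mul_lt {p q : F[X]} {m n : ℕ} (hp : p.degree < m) (hq : q.degree < (n + 1 : ℕ)) :
    (p * q).degree < (m + n : ℕ) := by
  rcases eq_or_ne p 0 with rfl | hp0
  · simp
  rcases eq_or_ne q 0 with rfl | hq0
  · simp
  rw [degree_mul]
  rw [degree_eq_natDegree hp0] at hp ⊢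
  rw [degree_eq_natDegree hq0] at hq ⊢
  norm_cast at hp hq ⊢
  omega

/-- Shares of any secret that vanish at `B` given points. -/
lemma exists_share_eq_zero {ι : Type} [DecidableEq ι] {B : ℕ} (a : ι → F) (J : Finset ι)
    (hJ : J.card ≤ B) (y c : F) (hy : ∀ n ∈ J, a n ≠ y) :
    ∃ R : degreeLT F B, ∀ n ∈ J, (sharePoly y c R).eval (a n) = 0 := by
  set P : F[X] := ∏ n ∈ J, (X - C (a n)) with hP
  have hPy : P.eval y ≠ 0 := by
    rw [hP, eval_prod, Finset.prod_ne_zero_iff]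
    intro n hn
    simpa [sub_eq_zero] using (hy n hn).symm
  -- The sharing polynomial is forced to vanish on `J`; the scalar gives it the value `c` at `y`, so
  -- `D - c` is divisible by `X - y` and the quotient is the randomness.
  set D : F[X] := C (c / P.eval y) * P with hD
  have hDy : D.eval y = c := by rw [hD, eval_mul, eval_C, div_mul_cancel₀ _ hPy]
  have hroot : (D - C c).IsRoot y := by simp [IsRoot, hDy]
  obtain ⟨R, hR⟩ := dvd_iff_isRoot.2 hroot
  have hdeg : R.degree < B := by
    rcases eq_or_ne R 0 with rfl | hR0
    · simp
    have h1 : (D - C c).degree ≤ B := by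
      refine (degree_sub_le _ _).trans (max_le ?_ (degree_C_le.trans (by exact_mod_cast B.zero_le)))
      rw [hD]
      refine (degree_mul_le _ _).trans ((add_le_add_left degree_C_le _).trans ?_)
      rw [hP, degree_prod]
      simpa using hJ
    rw [hR, degree_mul, degree_X_sub_C, degree_eq_natDegree hR0] at h1
    rw [degree_eq_natDegree hR0]
    norm_cast at h1 ⊢
    omega
  refine ⟨⟨R, mem_degreeLT.2 hdeg⟩, fun n hn => ?_⟩
  have : sharePoly y c ⟨R, mem_degreeLT.2 hdeg⟩ = D := by
    rw [sharePoly, ← hR]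
    ring
  have hPn : P.eval (a n) = 0 := by
    rw [hP, eval_prod]
    exact Finset.prod_eq_zero hn (by simp)
  rw [this, hD, eval_mul, hPn, mul_zero]

lemma exists_eval_eq {ι : Type} [DecidableEq ι] {m : ℕ} (a : ι → F) (J : Finset ι)
    (hJ : J.card ≤ m) (ha : Function.Injective a) (r : ι → F) :
    ∃ Z : degreeLT F m, ∀ n ∈ J, Z.1.eval (a n) = r n :=
  ⟨⟨Lagrange.interpolate J a r, mem_degreeLT.2
    ((Lagrange.degree_interpolate_lt r ha.injOn).trans_le (by exact_mod_cast hJ))⟩,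
    fun _ hn => Lagrange.eval_interpolate_at_node r ha.injOn hn⟩

variable {L : ℕ} (f : Fin L → F)

/-- The polynomial that vanishes at all secret positions. -/
noncomputable def nodal : F[X] := ∏ l, (X - C (f l))

/-- The polynomial that vanishes at all secret positions but one. -/
noncomputable def nodalErase (l : Fin L) : F[X] := ∏ j ∈ Finset.univ.erase l, (X - C (f j))

lemma nodalErase_mul (l : Fin L) : nodalErase f l * (X - C (f l)) = nodal f := by
  rw [nodalErase, nodal, mul_comm, Finset.mul_prod_erase _ (fun j => X - C (f j)) (Finset.mem_univ l)]

lemma eval_nodalErase_mul (l : Fin L) (x : F) :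
    (nodalErase f l).eval x * (x - f l) = (nodal f).eval x := by
  rw [← nodalErase_mul f l]
  simp

lemma eval_nodal_ne_zero {x : F} (hx : ∀ l, x ≠ f l) : (nodal f).eval x ≠ 0 := by
  rw [nodal, eval_prod, Finset.prod_ne_zero_iff]
  exact fun l _ => by simpa [sub_eq_zero] using hx l

lemma eval_nodal_self (l : Fin L) : (nodal f).eval (f l) = 0 := by
  rw [← eval_nodalErase_mul f l, sub_self, mul_zero]

lemma eval_nodalErase_self_ne_zero (hf : Function.Injective f) (l : Fin L) :
    (nodalErase f l).eval (f l) ≠ 0 := by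
  rw [nodalErase, eval_prod, Finset.prod_ne_zero_iff]
  intro j hj
  have : f l ≠ f j := fun h => (Finset.ne_of_mem_erase hj) (hf h).symm
  simpa [sub_eq_zero] using this

lemma eval_nodalErase_of_ne {l j : Fin L} (h : j ≠ l) : (nodalErase f l).eval (f j) = 0 := by
  rw [nodalErase, eval_prod]
  exact Finset.prod_eq_zero (Finset.mem_erase.2 ⟨h, Finset.mem_univ j⟩) (by simp)

lemma degree_nodal_lt : (nodal f).degree < (L + 1 : ℕ) := by
  rw [nodal, degree_prod]
  simp only [degree_X_sub_C, Finset.sum_const, Finset.card_univ, Fintype.card_fin, nsmul_eq_mul,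
    mul_one]
  exact_mod_cast Nat.lt_succ_self L

lemma degree_nodalErase_lt (l : Fin L) : (nodalErase f l).degree < L := by
  rw [nodalErase, degree_prod]
  simp only [degree_X_sub_C, Finset.sum_const, Finset.card_erase_of_mem (Finset.mem_univ l),
    Finset.card_univ, Fintype.card_fin, nsmul_eq_mul, mul_one]
  exact_mod_cast Nat.sub_lt l.pos one_pos

end Polynomials

/-! ### The scheme attaining the rate. -/

section Construction

variable {F : Type} [Field F] {N K L : ℕ} (a : Fin N → F) (f : Fin L → F) (B : ℕ)

/-- Shares for server `n` of the matrix `c` of secrets. -/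
noncomputable def share {B : ℕ} (c : Fin L → Fin K → F) (R : Fin L → Fin K → degreeLT F B)
    (n : Fin N) (l : Fin L) (k : Fin K) : F :=
  (sharePoly (f l) (c l k) (R l k)).eval (a n)

/-- Shares of the messages. -/
noncomputable def storeShare {B : ℕ} (w : Fin K → Fin L → F) (R : Fin L → Fin K → degreeLT F B) :
    Fin N → Fin L → Fin K → F :=
  share a f (fun l k => w k l) R

variable (F) in
/-- The unit vector of the required index. -/
abbrev unitVec (θ : Fin K) : Fin K → F := Pi.single θ 1

/-- Shares of the unit vector of the required index. -/
noncomputable def queryShare {B : ℕ} (θ : Fin K) (U : Fin L → Fin K → degreeLT F B) :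
    Fin N → Fin L → Fin K → F :=
  share a f (fun _ => unitVec F θ) U

/-- The masks. -/
noncomputable def maskShare {m : ℕ} (Z : degreeLT F m) (n : Fin N) : F :=
  (nodal f).eval (a n) * Z.1.eval (a n)

/-- The inner product of storage and query computed by server `n`. -/
noncomputable def respond (n : Fin N) (s q : Fin L → Fin K → F) : F :=
  ∑ l, (nodalErase f l).eval (a n) * ∑ k, s l k * q l k

open Classical in
/-- Decoding of a Reed-Solomon code with `B` errors, followed by evaluation at the secret
positions. -/
noncomputable def decodeWord (A : Fin N → F) (l : Fin L) : F :=
  if h : ∃ p : F[X], p.degree < (N - 2 * B : ℕ) ∧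
      (Finset.univ.filter fun n => p.eval (a n) ≠ A n).card ≤ B then
    h.choose.eval (f l) / (nodalErase f l).eval (f l)
  else 0

variable {a f B}

lemma share_add (c c' : Fin L → Fin K → F) (R R' : Fin L → Fin K → degreeLT F B) (n : Fin N) :
    share a f (c + c') (R + R') n = share a f c R n + share a f c' R' n := by
  funext l k
  simp only [share, eval_sharePoly, Pi.add_apply, Submodule.coe_add, eval_add]
  ring

lemma storeShare_add (w w' : Fin K → Fin L → F) (R R' : Fin L → Fin K → degreeLT F B)
    (n : Fin N) :
    storeShare a f (w + w') (R + R') n = storeShare a f w R n + storeShare a f w' R' n :=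
  share_add (fun l k => w k l) (fun l k => w' k l) R R' n

lemma maskShare_add {m : ℕ} (Z Z' : degreeLT F m) (n : Fin N) :
    maskShare a f (Z + Z') n = maskShare a f Z n + maskShare a f Z' n := by
  simp only [maskShare, Submodule.coe_add, eval_add]
  ring

lemma respond_add_left (n : Fin N) (s s' q : Fin L → Fin K → F) :
    respond a f n (s + s') q = respond a f n s q + respond a f n s' q := by
  simp only [respond, Pi.add_apply, add_mul, Finset.sum_add_distrib, mul_add]

lemma respond_zero_left (n : Fin N) (q : Fin L → Fin K → F) : respond a f n 0 q = 0 := by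
  simp [respond]

/-- Secrets can be shared so that the shares of any `B` servers vanish. -/
lemma exists_share_zero (haf : ∀ n l, a n ≠ f l) (J : Finset (Fin N)) (hJ : J.card ≤ B)
    (c : Fin L → Fin K → F) :
    ∃ R : Fin L → Fin K → degreeLT F B, ∀ n ∈ J, share a f c R n = 0 := by
  choose R hR using fun l k => exists_share_eq_zero a J hJ (f l) (c l k) fun n _ => haf n l
  exact ⟨R, fun n hn => funext fun l => funext fun k => hR l k n hn⟩

/-- The masks of up to `2B` servers can compensate any change of their answers. -/
lemma exists_mask_cancel (ha : Function.Injective a) (haf : ∀ n l, a n ≠ f l)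
    (J : Finset (Fin N)) (hJ : J.card ≤ 2 * B) (r : Fin N → F) :
    ∃ Z : degreeLT F (2 * B), ∀ n ∈ J, r n + maskShare a f Z n = 0 := by
  obtain ⟨Z, hZ⟩ := exists_eval_eq a J hJ ha fun n => -r n / (nodal f).eval (a n)
  refine ⟨Z, fun n hn => ?_⟩
  rw [maskShare, hZ n hn, mul_div_cancel₀ _ (eval_nodal_ne_zero f (haf n)), add_neg_cancel]

/-- The masks can compensate the addition of shares of messages that leave the required one
unchanged. -/
lemma exists_mask_cancel_all (w : Fin K → Fin L → F) (R U : Fin L → Fin K → degreeLT F B)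
    (θ : Fin K) (hw : w θ = 0) :
    ∃ Z : degreeLT F (2 * B), ∀ n : Fin N,
      respond a f n (storeShare a f w R n) (queryShare a f θ U n) + maskShare a f Z n = 0 := by
  -- With $e$ the unit vector, $w_ke_k=0$ for all $k$, so the product of the two shares has no
  -- constant term in $x-f_l$: it is $(x-f_l)(Uw+R\,(e+(x-f_l)U))$. The factor `nodalErase`
  -- completes $x-f_l$ to `nodal`, so the whole response is `nodal` times `P` and the mask `-P`
  -- cancels it at every server.
  set P : F[X] := ∑ l, ∑ k, ((U l k).1 * C (w k l) +
    (R l k).1 * sharePoly (f l) (unitVec F θ k) (U l k)) with hPdef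
  have hP : P ∈ degreeLT F (2 * B) := by
    refine Submodule.sum_mem _ fun l _ => Submodule.sum_mem _ fun k _ => ?_
    rw [two_mul]
    refine Submodule.add_mem _ (mem_degreeLT.2 ?_) (mem_degreeLT.2 ?_)
    · refine degree_mul_lt (mem_degreeLT.1 (U l k).2) (degree_C_le.trans_lt ?_)
      exact_mod_cast Nat.succ_pos B
    · exact degree_mul_lt (mem_degreeLT.1 (R l k).2) (degree_sharePoly_lt _ _ _)
  refine ⟨-⟨P, hP⟩, fun n => ?_⟩
  have h : ∀ l, ∑ k, storeShare a f w R n l k * queryShare a f θ U n l k =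
      (a n - f l) * ∑ k, ((U l k).1 * C (w k l) + (R l k).1 *
        sharePoly (f l) (unitVec F θ k) (U l k)).eval (a n) := by
    intro l
    rw [Finset.mul_sum]
    refine Finset.sum_congr rfl fun k _ => ?_
    have h0 : w k l * unitVec F θ k = 0 := by
      rcases eq_or_ne k θ with rfl | hk
      · rw [hw]; simp
      · simp [hk]
    simp only [storeShare, queryShare, share, eval_sharePoly, eval_add, eval_mul, eval_C]
    linear_combination h0
  simp only [respond, h, maskShare, Submodule.coe_neg, eval_neg, hPdef, eval_finsetSum,
    ← mul_assoc, eval_nodalErase_mul]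
  rw [← Finset.mul_sum]
  ring

/-- The polynomial whose values are the honest answers. -/
noncomputable def answerPoly (w : Fin K → Fin L → F) (R U : Fin L → Fin K → degreeLT F B)
    (Z : degreeLT F (2 * B)) (f : Fin L → F) (θ : Fin K) : F[X] :=
  ∑ l, nodalErase f l * ∑ k, sharePoly (f l) (w k l) (R l k) *
    sharePoly (f l) (unitVec F θ k) (U l k) + nodal f * Z.1

lemma eval_answerPoly (w : Fin K → Fin L → F) (R U : Fin L → Fin K → degreeLT F B)
    (Z : degreeLT F (2 * B)) (θ : Fin K) (n : Fin N) :
    (answerPoly w R U Z f θ).eval (a n) =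
      respond a f n (storeShare a f w R n) (queryShare a f θ U n) + maskShare a f Z n := by
  simp only [answerPoly, respond, storeShare, queryShare, share, maskShare, eval_add, eval_mul,
    eval_finsetSum]

/-- At the position `f l` the mask vanishes with `nodal`, the blocks of all other positions vanish
with their `nodalErase`, and the shares in the remaining block take their secret values. -/
lemma eval_answerPoly_secret (w : Fin K → Fin L → F) (R U : Fin L → Fin K → degreeLT F B)
    (Z : degreeLT F (2 * B)) (θ : Fin K) (l : Fin L) :
    (answerPoly w R U Z f θ).eval (f l) = (nodalErase f l).eval (f l) * w θ l := by
  simp only [answerPoly, eval_add, eval_mul, eval_finsetSum, eval_nodal_self, zero_mul, add_zero]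
  rw [Finset.sum_eq_single l]
  · congr 1
    simp [eval_sharePoly_self, Pi.single_apply]
  · intro j _ hj
    rw [eval_nodalErase_of_ne f hj.symm, zero_mul]
  · simp

lemma degree_answerPoly_lt (w : Fin K → Fin L → F) (R U : Fin L → Fin K → degreeLT F B)
    (Z : degreeLT F (2 * B)) (θ : Fin K) :
    (answerPoly w R U Z f θ).degree < (L + 2 * B : ℕ) := by
  rw [← mem_degreeLT]
  refine Submodule.add_mem _ (Submodule.sum_mem _ fun l _ => mem_degreeLT.2 ?_)
    (mem_degreeLT.2 ?_)
  · refine degree_mul_lt (degree_nodalErase_lt f l) (mem_degreeLT.1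
      (Submodule.sum_mem _ fun k _ => mem_degreeLT.2 ?_))
    have := degree_mul_lt (degree_sharePoly_lt (f l) (w k l) (R l k))
      (degree_sharePoly_lt (f l) (unitVec F θ k) (U l k))
    rwa [show B + 1 + B = 2 * B + 1 by ring] at this
  · rw [mul_comm, add_comm L]
    exact degree_mul_lt (mem_degreeLT.1 Z.2) (degree_nodal_lt f)

/-- Uniqueness of decoding: two candidates, each contradicted by at most `B` answers, agree at `N -
2 * B` points or more and hence coincide. So it does not matter which one the choice in `decodeWord`
returns. -/
lemma decodeWord_eq (ha : Function.Injective a) {A : Fin N → F} (hB : 4 * B ≤ N) {p : F[X]}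
    (hp : p.degree < (N - 2 * B : ℕ)) (J : Finset (Fin N)) (hJ : J.card ≤ B)
    (hpA : ∀ n ∉ J, p.eval (a n) = A n) (l : Fin L) :
    decodeWord a f B A l = p.eval (f l) / (nodalErase f l).eval (f l) := by
  classical
  have hex : ∃ p : F[X], p.degree < (N - 2 * B : ℕ) ∧
      (Finset.univ.filter fun n => p.eval (a n) ≠ A n).card ≤ B := by
    refine ⟨p, hp, (Finset.card_le_card fun n hn => ?_).trans hJ⟩
    by_contra h
    exact (Finset.mem_filter.1 hn).2 (hpA n h)
  rw [decodeWord, dif_pos hex]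
  obtain ⟨h1, h2⟩ := hex.choose_spec
  set p' := hex.choose
  set J' := Finset.univ.filter fun n => p'.eval (a n) ≠ A n
  have hcard : N - 2 * B ≤ (J ∪ J')ᶜ.card := by
    rw [Finset.card_compl, Fintype.card_fin]
    have := Finset.card_union_le J J'
    omega
  rw [eq_of_degrees_lt_of_eval_index_eq (f := p') (g := p) (J ∪ J')ᶜ (v := a) ha.injOn
    (h1.trans_le (by exact_mod_cast hcard)) (hp.trans_le (by exact_mod_cast hcard))]
  intro n hn
  rw [Finset.mem_compl, Finset.mem_union, not_or] at hn
  rw [hpA n hn.1]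
  by_contra h
  exact hn.2 (Finset.mem_filter.2 ⟨Finset.mem_univ n, h⟩)

/-- A coalition reacts only to what it sees: changes of storage and masks outside the coalition
affect a received answer only through the honest answer of that server. -/
lemma received_congr {S : Scheme N K} (byz : Byzantine S B) {s s' : (n : Fin N) → S.Stor n}
    {q : (n : Fin N) → S.Que n} {z z' : (n : Fin N) → S.Mask n} {γ : byz.servers → byz.Aux}
    (hs : ∀ n ∈ byz.servers, s n = s' n) (hz : ∀ n ∈ byz.servers, z n = z' n) (n : Fin N)
    (h : S.answer n (s n) (q n) (z n) = S.answer n (s' n) (q n) (z' n)) :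
    received S byz s q z γ n = received S byz s' q z' γ n := by
  have hs' : (fun m : byz.servers => s m) = fun m : byz.servers => s' m := funext fun m => hs m.1 m.2
  have hz' : (fun m : byz.servers => z m) = fun m : byz.servers => z' m := funext fun m => hz m.1 m.2
  simp only [received, hs', hz', h]

variable [Fintype F] (a f B)

/-- Retrieval by cross-subspace alignment: storage and queries are secret shares with `B`-fold
randomness, whose products are aligned in a space that is hidden by the masks. -/
noncomputable abbrev csaScheme (K : ℕ) (hL : 0 < L) : Scheme N K where
  Sym := F
  L := L
  L_pos := hL
  Stor _ := Fin L → Fin K → F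
  Que _ := Fin L → Fin K → F
  Mask _ := F
  Ans _ := F
  storage w := (PMF.uniformOfFintype (Fin L → Fin K → degreeLT F B)).map (storeShare a f w)
  masking := (PMF.uniformOfFintype (degreeLT F (2 * B))).map (maskShare a f)
  query θ := (PMF.uniformOfFintype (Fin L → Fin K → degreeLT F B)).map (queryShare a f θ)
  answer n s q z := respond a f n s q + z
  decode _ _ A := decodeWord a f B A

variable {a f B}

/-- The outcome of a run as a function of the independent sources of randomness. -/
noncomputable def csaOutcome {hL : 0 < L} (byz : Byzantine (csaScheme a f B K hL) B) (θ : Fin K)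
    (w : Fin K → Fin L → F) (R U : Fin L → Fin K → degreeLT F B) (Z : degreeLT F (2 * B))
    (γ : byz.servers → byz.Aux) : Outcome (csaScheme a f B K hL) :=
  ⟨θ, w, storeShare a f w R, maskShare a f Z, queryShare a f θ U,
    received (csaScheme a f B K hL) byz (storeShare a f w R) (queryShare a f θ U)
      (maskShare a f Z) γ⟩

/-- The query randomness is drawn before the masks, so that the masks can be translated by an amount
that depends on the queries. -/
lemma lawGiven_csaScheme {hL : 0 < L} (byz : Byzantine (csaScheme a f B K hL) B) (θ : Fin K) :
    lawGiven (csaScheme a f B K hL) byz θ =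
      (PMF.uniformOfFintype (Fin K → Fin L → F)).bind fun w =>
      (PMF.uniformOfFintype (Fin L → Fin K → degreeLT F B)).bind fun R =>
      (PMF.uniformOfFintype (Fin L → Fin K → degreeLT F B)).bind fun U =>
      (PMF.uniformOfFintype (degreeLT F (2 * B))).bind fun Z =>
      byz.aux.map fun γ => csaOutcome byz θ w R U Z γ := by
  simp only [lawGiven, PMF.bind_map]
  refine congrArg _ (funext fun w => congrArg _ (funext fun R => ?_))
  exact PMF.bind_comm _ _ _

/-- Invariance of the law of a run under translations of its randomness. -/
lemma lawGiven_map_shift {hL : 0 < L} (byz : Byzantine (csaScheme a f B K hL) B) (θ : Fin K)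
    {α : Type} (g g' : Outcome (csaScheme a f B K hL) → α) (δw : Fin K → Fin L → F)
    (δR : Fin L → Fin K → degreeLT F B) (δZ : (Fin L → Fin K → degreeLT F B) → degreeLT F (2 * B))
    (h : ∀ w R U Z γ, g (csaOutcome byz θ w R U Z γ) =
      g' (csaOutcome byz θ (w + δw) (R + δR) U (Z + δZ U) γ)) :
    (lawGiven (csaScheme a f B K hL) byz θ).map g =
      (lawGiven (csaScheme a f B K hL) byz θ).map g' := by
  simp only [lawGiven_csaScheme, PMF.map_bind, PMF.map_comp, Function.comp_def, h]
  refine Eq.trans ?_ (PMF.uniformOfFintype_bind_add δw _).symm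
  refine congrArg _ (funext fun w => Eq.trans ?_ (PMF.uniformOfFintype_bind_add δR _).symm)
  exact congrArg _ (funext fun R => congrArg _ (funext fun U =>
    (PMF.uniformOfFintype_bind_add (δZ U) fun Z => byz.aux.map fun γ =>
      g' (csaOutcome byz θ (w + δw) (R + δR) U Z γ)).symm))

/-- Translate the messages by `δ`, with shares of `δ` that vanish at the Byzantine servers, and let
the `2 * B` degrees of freedom of the mask undo the effect on the answers of `I` and of the
Byzantine servers. The latter then see no change at all. The map `φ` lets one statement serve both
the eavesdropper and the Byzantine answers. -/
lemma csaScheme_eavesdropper (ha : Function.Injective a) (haf : ∀ n l, a n ≠ f l) {hL : 0 < L}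
    (byz : Byzantine (csaScheme a f B K hL) B) (θ : Fin K) (I : Finset (Fin N))
    (hI : (I ∪ byz.servers).card ≤ 2 * B) {α : Type} [Fintype α]
    (φ : ((n : I) → (csaScheme a f B K hL).Que n) × ((n : I) → (csaScheme a f B K hL).Ans n) → α) :
    mutualInfo (lawGiven (csaScheme a f B K hL) byz θ)
      (fun ω => φ (ω.que I, ω.ans I)) Outcome.W = 0 := by
  refine mutualInfo_eq_zero_of_transitive _ _ _ fun w₀ w₁ => ?_
  set δ : Fin K → Fin L → F := w₁ - w₀ with hδ
  refine ⟨fun w => (w + δ : Fin K → Fin L → F), fun x y h => add_right_cancel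
    (G := Fin K → Fin L → F) h, add_sub_cancel (G := Fin K → Fin L → F) w₀ w₁, ?_⟩
  obtain ⟨δR, hR⟩ := exists_share_zero haf byz.servers byz.card_le fun l k => δ k l
  choose δZ hZ using fun U : Fin L → Fin K → degreeLT F B => exists_mask_cancel ha haf
    (I ∪ byz.servers) hI
    fun n => respond a f n (storeShare a f δ δR n) (queryShare a f θ U n)
  have hZ0 : ∀ U, ∀ n ∈ byz.servers, maskShare a f (δZ U) n = 0 := by
    intro U n hn
    have h := hZ U n (Finset.mem_union_right _ hn)
    rwa [show storeShare a f δ δR n = 0 from hR n hn, respond_zero_left, zero_add] at h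
  refine lawGiven_map_shift byz θ _ _ δ δR δZ fun w R U Z γ => ?_
  refine Prod.ext (congrArg φ (Prod.ext rfl (funext fun n => ?_))) rfl
  refine received_congr byz (fun n hn => ?_) (fun n hn => ?_) n ?_
  · rw [storeShare_add, show storeShare a f δ δR n = 0 from hR n hn, add_zero]
  · rw [maskShare_add, hZ0 U n hn, add_zero]
  · have h := hZ U n (Finset.mem_union_left _ n.2)
    dsimp only
    rw [storeShare_add, maskShare_add, respond_add_left]
    linear_combination -h

/-- Here the translation fixes the required message, so the mask can undo its effect on all answers
at once. -/
lemma csaScheme_symmetric (haf : ∀ n l, a n ≠ f l) {hL : 0 < L}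
    (byz : Byzantine (csaScheme a f B K hL) B) (θ : Fin K) :
    mutualInfo (lawGiven (csaScheme a f B K hL) byz θ)
      (Outcome.others θ) (fun ω => (ω.A, ω.Q)) = 0 := by
  rw [mutualInfo_comm]
  refine mutualInfo_eq_zero_of_transitive _ _ _ fun o₀ o₁ => ?_
  set δ : {j : Fin K // j ≠ θ} → Fin L → F := o₁ - o₀ with hδ
  refine ⟨fun w => (w + δ : {j : Fin K // j ≠ θ} → Fin L → F), fun x y h => add_right_cancel
    (G := {j : Fin K // j ≠ θ} → Fin L → F) h,
    add_sub_cancel (G := {j : Fin K // j ≠ θ} → Fin L → F) o₀ o₁, ?_⟩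
  set δw : Fin K → Fin L → F := fun k => if h : k ≠ θ then δ ⟨k, h⟩ else 0 with hδw
  obtain ⟨δR, hR⟩ := exists_share_zero haf byz.servers byz.card_le fun l k => δw k l
  choose δZ hZ using fun U : Fin L → Fin K → degreeLT F B =>
    exists_mask_cancel_all (a := a) (f := f) δw δR U θ (by simp [hδw])
  have hZ0 : ∀ U, ∀ n ∈ byz.servers, maskShare a f (δZ U) n = 0 := by
    intro U n hn
    have h := hZ U n
    rwa [show storeShare a f δw δR n = 0 from hR n hn, respond_zero_left, zero_add] at h
  refine lawGiven_map_shift byz θ _ _ δw δR δZ fun w R U Z γ => ?_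
  refine Prod.ext (Prod.ext (funext fun n => ?_) rfl) (funext fun j => ?_)
  · refine received_congr byz (fun n hn => ?_) (fun n hn => ?_) n ?_
    · rw [storeShare_add, show storeShare a f δw δR n = 0 from hR n hn, add_zero]
    · rw [maskShare_add, hZ0 U n hn, add_zero]
    · have h := hZ U n
      dsimp only
      rw [storeShare_add, maskShare_add, respond_add_left]
      linear_combination -h
  · have : δw j = δ j := by simp [hδw, j.2]
    exact congrArg (fun x : Fin L → F => w j + x) this.symm

lemma csaScheme_secure [NeZero K] (haf : ∀ n l, a n ≠ f l) {hL : 0 < L}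
    (byz : Byzantine (csaScheme a f B K hL) B) (I : Finset (Fin N)) (hI : I.card ≤ B) :
    mutualInfo (law (csaScheme a f B K hL) byz) (Outcome.stor I) Outcome.W = 0 := by
  refine mutualInfo_eq_zero_of_transitive _ _ _ fun w₀ w₁ => ?_
  set δ : Fin K → Fin L → F := w₁ - w₀ with hδ
  refine ⟨fun w => (w + δ : Fin K → Fin L → F), fun x y h => add_right_cancel
    (G := Fin K → Fin L → F) h, add_sub_cancel (G := Fin K → Fin L → F) w₀ w₁, ?_⟩
  obtain ⟨δR, hR⟩ := exists_share_zero haf I hI fun l k => δ k l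
  simp only [law, PMF.map_bind]
  refine congrArg _ (funext fun θ => ?_)
  refine lawGiven_map_shift byz θ _ _ δ δR (fun _ => 0) fun w R U Z γ => ?_
  refine Prod.ext (funext fun n => ?_) rfl
  change storeShare a f w R n = storeShare a f (w + δ) (R + δR) n
  rw [storeShare_add, show storeShare a f δ δR n = 0 from hR n n.2, add_zero]

lemma csaScheme_private [NeZero K] (haf : ∀ n l, a n ≠ f l) {hL : 0 < L}
    (byz : Byzantine (csaScheme a f B K hL) B) (I : Finset (Fin N)) (hI : I.card ≤ B) :
    mutualInfo (law (csaScheme a f B K hL) byz) (Outcome.que I) Outcome.θ = 0 := by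
  refine mutualInfo_eq_zero_of_map_eq _ _ _ (PMF.uniformOfFintype (Fin K))
    ((PMF.uniformOfFintype (Fin L → Fin K → degreeLT F B)).map
      fun U => fun n : I => queryShare a f 0 U n) ?_
  have hque : ∀ ω : Outcome (csaScheme a f B K hL), ω.que I = fun n : I => ω.Q n := fun _ => rfl
  simp only [law, lawGiven_csaScheme, PMF.map_bind, PMF.map_comp, Function.comp_def, hque,
    csaOutcome, PMF.map_fun_const, PMF.bind_const]
  refine congrArg _ (funext fun θ => ?_)
  -- Shares of the difference of two unit vectors that vanish on `I` turn the queries for index 0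
  -- into those for `θ` without any change on `I`.
  obtain ⟨δU, hU⟩ := exists_share_zero haf I hI
    fun _ : Fin L => unitVec F θ - unitVec F 0
  refine (PMF.uniformOfFintype_bind_add δU _).trans (congrArg _ (funext fun U => ?_))
  refine congrArg PMF.pure (Prod.ext (funext fun n => ?_) rfl)
  have h := share_add (a := a) (f := f) (fun _ => unitVec F 0)
    (fun _ => unitVec F θ - unitVec F 0) U δU n
  rw [hU n n.2, add_zero] at h
  refine Eq.trans ?_ h
  change share a f (fun _ => unitVec F θ) (U + δU) n = _
  congr 1
  funext l k
  simp

lemma csaScheme_correct (ha : Function.Injective a) (hf : Function.Injective f) {hL : 0 < L}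
    (hN : L + 4 * B = N) (byz : Byzantine (csaScheme a f B K hL) B) (θ : Fin K)
    (ω : Outcome (csaScheme a f B K hL))
    (hω : ω ∈ (lawGiven (csaScheme a f B K hL) byz θ).support) :
    decodeWord a f B ω.A = ω.W θ := by
  simp only [lawGiven_csaScheme, PMF.mem_support_bind_iff, PMF.mem_support_map_iff] at hω
  obtain ⟨w, -, R, -, U, -, Z, -, γ, -, rfl⟩ := hω
  funext l
  have h := decodeWord_eq (f := f) ha (A := (csaOutcome byz θ w R U Z γ).A) (B := B) (by omega)
    (p := answerPoly w R U Z f θ)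
    (by rw [show N - 2 * B = L + 2 * B by omega]; exact degree_answerPoly_lt w R U Z θ)
    byz.servers byz.card_le (fun n hn => by
      rw [eval_answerPoly]
      exact (dif_neg hn : received (csaScheme a f B K hL) byz (storeShare a f w R)
        (queryShare a f θ U) (maskShare a f Z) γ n = _).symm) l
  rw [h, eval_answerPoly_secret, mul_div_cancel_left₀ _ (eval_nodalErase_self_ne_zero f hf l)]
  rfl

lemma csaScheme_isValid [NeZero K] (ha : Function.Injective a) (hf : Function.Injective f)
    (haf : ∀ n l, a n ≠ f l) (hL : 0 < L) (hN : L + 4 * B = N) {T E X : ℕ} (hT : T ≤ B)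
    (hE : E ≤ B) (hX : X ≤ B) : IsValid (csaScheme a f B K hL) B T E X where
  correct := csaScheme_correct ha hf hN
  symmetric := csaScheme_symmetric haf
  byzantine_answers byz θ := csaScheme_eavesdropper ha haf byz θ byz.servers
    (by rw [Finset.union_self]; have := byz.card_le; omega) Prod.snd
  byzantine_secure := csaScheme_secure haf
  byzantine_private := csaScheme_private haf
  secure byz I hI := csaScheme_secure haf byz I (hI.trans hX)
  colluding byz I hI := csaScheme_private haf byz I (hI.trans hT)
  eavesdropper byz θ I hI := csaScheme_eavesdropper ha haf byz θ I
    ((Finset.card_union_le _ _).trans (by have := byz.card_le; omega)) id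

/-- Each answer is one field symbol, so its entropy is at most one symbol whatever the Byzantine
servers do. -/
lemma csaScheme_rate [NeZero K] (hL : 0 < L) (hN : 0 < N) :
    ENNReal.ofReal (L / N) ≤ (csaScheme a f B K hL).rate B := by
  refine le_iInf fun byz => ?_
  have hlog : 0 < Real.log (Fintype.card F) :=
    Real.log_pos (by exact_mod_cast Fintype.one_lt_card (α := F))
  have hsum : ∑ n, shannonEntropy (law (csaScheme a f B K hL) byz) (fun ω => ω.A n) ≤
      N * Real.log (Fintype.card F) := by
    refine (Finset.sum_le_sum fun n _ => shannonEntropy_le_log_card _ _).trans (le_of_eq ?_)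
    simp
  have hNr : (0 : ℝ) < N := by exact_mod_cast hN
  calc ENNReal.ofReal (L / N) =
        ENNReal.ofReal (L * Real.log (Fintype.card F)) /
          ENNReal.ofReal (N * Real.log (Fintype.card F)) := by
        rw [← ENNReal.ofReal_div_of_pos (mul_pos hNr hlog), mul_div_mul_right _ _ hlog.ne']
    _ ≤ _ := ENNReal.div_le_div le_rfl (ENNReal.ofReal_le_ofReal hsum)

end Construction

end BSPIR

/-! ### Rate bounds and the limit. -/

namespace BSPIR

lemma Scheme.rate_le_of_isValid {N K B T E X : ℕ} [NeZero K] {S : Scheme N K}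
    (hS : IsValid S B T E X) (hN : 0 < N) (hB : 4 * B ≤ N) :
    S.rate B ≤ ENNReal.ofReal ((N - 3 * B : ℕ) /
      (N * ∑ i ∈ Finset.range K, ((B : ℝ) / (N - 3 * B : ℕ)) ^ i)) := by
  have hNr : (0 : ℝ) < N := by exact_mod_cast hN
  have hMr : (0 : ℝ) < (N - 3 * B : ℕ) := by exact_mod_cast (by omega : 0 < N - 3 * B)
  have hG : 0 < ∑ i ∈ Finset.range K, ((B : ℝ) / (N - 3 * B : ℕ)) ^ i :=
    geom_sum_pos (by positivity) (NeZero.ne K)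
  have hd := hS.download_ge hN hB
  set G := ∑ i ∈ Finset.range K, ((B : ℝ) / (N - 3 * B : ℕ)) ^ i
  set H := ∑ n, shannonEntropy (law S (Byzantine.none S B)) (fun ω => ω.A n) with hH
  have hs := S.size_pos
  have hHpos : 0 < H := by
    by_contra h
    have h1 : 0 < N * (S.size * G) := by positivity
    have h2 := mul_nonpos_of_nonneg_of_nonpos hMr.le (not_lt.1 h)
    linarith
  refine (iInf_le _ (Byzantine.none S B)).trans ?_
  change ENNReal.ofReal S.size / ENNReal.ofReal H ≤ _
  rw [← ENNReal.ofReal_div_of_pos hHpos]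
  refine ENNReal.ofReal_le_ofReal ?_
  rw [div_le_div_iff₀ hHpos (by positivity)]
  linarith

lemma tendsto_rate_bound (N B : ℕ) (hN : 0 < N) (hB : 4 * B ≤ N) :
    Tendsto (fun K : ℕ => ((N - 3 * B : ℕ) : ℝ) /
      (N * ∑ i ∈ Finset.range (K + 1), ((B : ℝ) / (N - 3 * B : ℕ)) ^ i)) atTop
      (𝓝 (1 - 4 * (B : ℝ) / N)) := by
  have hNr : (0 : ℝ) < N := by exact_mod_cast hN
  have hMr : (0 : ℝ) < (N - 3 * B : ℕ) := by exact_mod_cast (by omega : 0 < N - 3 * B)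
  have hM : ((N - 3 * B : ℕ) : ℝ) = N - 3 * B := by
    rw [Nat.cast_sub (by omega)]
    push_cast
    rfl
  rcases hB.eq_or_lt with h | h
  -- If `N = 4 * B`, the ratio is 1 and the sum grows without bound, so the bound tends to 0;
  -- otherwise the geometric series converges.
  · have hr : (B : ℝ) / (N - 3 * B : ℕ) = 1 := by
      rw [show N - 3 * B = B by omega]
      exact div_self (by exact_mod_cast (by omega : B ≠ 0))
    have hN4 : (1 : ℝ) - 4 * B / N = 0 := by
      rw [sub_eq_zero, eq_div_iff hNr.ne', one_mul]
      exact_mod_cast h.symm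
    simp only [hr, one_pow, Finset.sum_const, Finset.card_range, nsmul_eq_mul, mul_one, hN4]
    refine Tendsto.div_atTop tendsto_const_nhds (Tendsto.const_mul_atTop hNr ?_)
    exact tendsto_natCast_atTop_atTop.comp (tendsto_add_atTop_nat 1)
  · have hBr : (4 : ℝ) * B < N := by exact_mod_cast h
    have hr : (B : ℝ) / (N - 3 * B : ℕ) < 1 := by
      rw [div_lt_one hMr, hM]
      linarith
    have hsum := (hasSum_geometric_of_lt_one (by positivity) hr).tendsto_sum_nat.comp
      (tendsto_add_atTop_nat 1)
    have hne : (1 : ℝ) - B / (N - 3 * B : ℕ) ≠ 0 := (sub_pos.2 hr).ne'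
    have := (tendsto_const_nhds (x := ((N - 3 * B : ℕ) : ℝ))).div (hsum.const_mul (N : ℝ))
      (mul_ne_zero hNr.ne' (inv_ne_zero hne))
    refine this.congr' (Eventually.of_forall fun K => rfl) |>.trans (le_of_eq ?_)
    congr 1
    rw [hM] at hMr ⊢
    have h4 : (N : ℝ) - 3 * B - B ≠ 0 := by linarith
    field_simp
    ring

/-- Retrieval is possible at the rate `1 - 4 B / N`. -/
lemma le_capacity {N B T E X : ℕ} (K : ℕ) [NeZero K] (hN : 0 < N) (hB : 4 * B ≤ N) (hT : T ≤ B)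
    (hE : E ≤ B) (hX : X ≤ B) :
    ENNReal.ofReal (1 - 4 * (B : ℝ) / N) ≤ capacity N K B T E X := by
  have hNr : (0 : ℝ) < N := by exact_mod_cast hN
  have hrate : (1 : ℝ) - 4 * B / N = (N - 4 * B : ℕ) / N := by
    rw [Nat.cast_sub hB]
    push_cast
    field_simp
  rw [hrate]
  rcases Nat.eq_zero_or_pos (N - 4 * B) with h | hL
  -- For `N = 4 * B` the construction would have message length 0, but the claimed rate is 0.
  · simp [h]
  -- The field needs `N` evaluation points and `N - 4 * B` secret positions, all distinct.
  obtain ⟨p, hp, hprime⟩ := Nat.exists_infinite_primes (N + (N - 4 * B))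
  have := Fact.mk hprime
  have hcast : ∀ x y : ℕ, x < p → y < p → (x : ZMod p) = y → x = y := by
    intro x y hx hy hxy
    rw [ZMod.natCast_eq_natCast_iff'] at hxy
    rwa [Nat.mod_eq_of_lt hx, Nat.mod_eq_of_lt hy] at hxy
  let a : Fin N → ZMod p := fun n => ((n : ℕ) : ZMod p)
  let f : Fin (N - 4 * B) → ZMod p := fun l => ((N + l : ℕ) : ZMod p)
  have ha : Function.Injective a := fun n m hnm =>
    Fin.ext (hcast _ _ (by omega) (by omega) hnm)
  have hf : Function.Injective f := fun l j hlj => by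
    have := hcast _ _ (by omega) (by omega) hlj
    exact Fin.ext (by omega)
  have haf : ∀ n l, a n ≠ f l := fun n l hnl => by
    have := hcast _ _ (by omega) (by omega) hnl
    omega
  exact (csaScheme_rate (a := a) (f := f) hL hN).trans
    (le_iSup₂_of_le (csaScheme a f B K hL)
      (csaScheme_isValid ha hf haf hL (by omega) hT hE hX) le_rfl)

end BSPIR

theorem corollary1 (N B T E X : ℕ) (hN : 0 < N) (hB : 4 * B ≤ N)
    (hTE : max T E ≤ B) (hX : X ≤ B) :
    Tendsto (fun K : ℕ => BSPIR.capacity N (K + 1) B T E X) atTop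
      (𝓝 (ENNReal.ofReal (1 - 4 * (B : ℝ) / (N : ℝ)))) := by
  refine tendsto_of_tendsto_of_tendsto_of_le_of_le tendsto_const_nhds
    (ENNReal.tendsto_ofReal (BSPIR.tendsto_rate_bound N B hN hB)) (fun K => ?_) fun K => ?_
  · exact BSPIR.le_capacity (K + 1) hN hB ((le_max_left _ _).trans hTE)
      ((le_max_right _ _).trans hTE) hX
  · exact iSup₂_le fun S hS => BSPIR.Scheme.rate_le_of_isValid hS hN hB
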